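/- Let $M$ be a paracompact Hausdorff smooth 3-manifold and $G=SU(2)\ltimes\mathbb R^3$ the Poincaré group, where $SU(2)$ acts on $\mathbb R^3$ by rotations; its Lie algebra is $[L_i,L_j]=\epsilon_{ijk}L_k$, $[L_i,Q_j]=\epsilon_{ijk}Q_k$, $[Q_i,Q_j]=0$ (indices are moved with $\delta_{ij}$). Let $\pi:P\to M$ be a smooth principal $G$-bundle, trivialized over an open cover $(U_a)$, with a connection $H$, whose gauge potentials on $U_a$ are $H=A^iL_i+\theta^iQ_i$. (1) The adjoint action of $SU(2)$ is a continuous surjective homomorphism $\Gamma_1:SU(2)\to SO(3)$ with kernel $\{\pm1\}$, whose differential sends $L_k$ to $\tfrac12\epsilon_{kpq}L_{pq}$, where $L_{pq}=E_{qp}-E_{pq}$ are the generators of $SO(3)$. (2) $P$ contains a sub-bundle $P_A$ with structure group $SU(2)$ over all of $M$ (a reduction of $P$ to the stability group). (3) Let $P_A$ be any such sub-bundle and use on each $U_a$ the section of $P_A$ obtained by translating the given one along $\mathbb R^3$. Let $A^i,\theta^i$ be the potentials of $H$ in this section, and put $F^i=dA^i+\tfrac12\epsilon_{ijk}A^jA^k$,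 $\Pi^i=d\theta^i+\epsilon_{ijk}A^j\theta^k$. Suppose that $v\mapsto(\theta^i(v))_i$ is an isomorphism $T_xM\to\mathbb R^3$ at every point, and let $\mu\ne0$ be real. Then there are an oriented Riemannian metric on $M$, making it a Riemann–Cartan manifold $M'$; its principal $SO(3)$-bundle $P'_X$ of oriented orthonormal coframes, with soldering form $e^i$, spin connection $\omega^{ij}=-\omega^{ji}$, curvature $\Omega^{ij}=d\omega^{ij}+\omega^{ik}\omega^{kj}$ and torsion $T^i=de^i+\omega^{ij}e^j$; and a continuous map $f:P\to P'_X$, with the following properties. * $f$ is a bundle map: it covers $\Gamma_3=\mathrm{id}:M\to M'$, satisfies $f(p\cdot(u,w))=f(p)\cdot\Gamma_1(u)$ for $(u,w)\in G$, is $(x,(u,w))\mapsto(x,\Gamma_1(u))$ in local trivializations of $P$ and $P'_X$ over each $U_a$, and maps $P_A$ onto $P'_X$. * $\Gamma_4:(A,\theta)\mapsto(\omega,e)$ is given by $A^k=-\tfrac12\epsilon^{kij}\omega_{ij}$, $\theta^i=\mu e^i$. Moreover $\Omega^{ij}=-\epsilon^{ijk}F_k$, $T^i=\mu^{-1}\Pi^i$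 and $\theta^iF_i=-\tfrac{\mu}{2}\epsilon_{ijk}e^i\Omega^{jk}$ (the Chern–Simons Lagrangian, up to a constant factor and an exact form, becomes the Einstein–Hilbert one). On each $U_a$, for smooth parameters, the gauge transformations $\delta H=d\varrho+[H,\varrho]$, $\varrho=\alpha^iL_i+\zeta^iQ_i$, become $\delta\omega^{ij}=\nabla\alpha^{ij}$, $\delta e^i=\nabla\vartheta^i-\alpha^{ij}e^j$ with $\alpha^{ij}=-\epsilon^{ijk}\alpha_k$ and $\vartheta^i=\mu^{-1}\zeta^i$. * $\Gamma_2$: there is a linear isomorphism from the $\mathbb R^3$ gauge parameters $\zeta$ (smooth sections of the vector bundle $P\times_G\mathbb R^3$, where $G$ acts through $\Gamma_1$) to the smooth vector fields $X$ on $M'$, determined by $i_Xe^i=\mu^{-1}\zeta^i$. Let $\mathrm{Diff}(D)_X$ be the space of smooth vector fields $X$ with $i_X\Omega^{ij}=0$ and $i_XT^i=0$. Then $X$ lies in $\mathrm{Diff}(D)_X$ if and only if, over each $U_a$ and acting on both $\omega$ and $e$, one has $\mathcal L_X-\delta_{\mathbb R^3}=\delta_{SO(3)}$, where $\delta_{\mathbb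 R^3}$ has parameters $\alpha^{ij}=0$, $\vartheta^i=i_Xe^i$ and $\delta_{SO(3)}$ has parameters $\alpha^{ij}=i_X\omega^{ij}$, $\vartheta^i=0$. * The space of tangent vectors $v$ at a point with $i_v\Omega=0$ and $i_vT=0$ has dimension $D\le3$, and $\mathrm{Diff}(D)_X$ contains all smooth vector fields if and only if $\Omega=0$ and $T=0$ everywhere; so the diffeomorphism symmetry is partially broken otherwise. -/

import Mathlib

open scoped Manifold Matrix

namespace GaugeGravity

/-! ### The groups `SU(2)`, `SO(3)` and the covering homomorphism -/

abbrev SU2 := Matrix.specialUnitaryGroup (Fin 2) ℂ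

abbrev SO3 := Matrix.specialOrthogonalGroup (Fin 3) ℝ

/-- The Levi-Civita symbol `ε_{ijk}`, with `ε_{012} = 1`. Indices are moved with the Euclidean
metric, so their position is irrelevant. -/
noncomputable def eps (i j k : Fin 3) : ℝ :=
  (((j : ℕ) : ℝ) - (i : ℕ)) * (((k : ℕ) : ℝ) - (j : ℕ)) * (((k : ℕ) : ℝ) - (i : ℕ)) / 2

/-- The generators `L_i = -(i/2) σ_i` of `su(2)`, which satisfy `[L_i, L_j] = ε_{ijk} L_k`. -/
noncomputable def su2Gen : Fin 3 → Matrix (Fin 2) (Fin 2) ℂ :=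
  ![!![0, -Complex.I / 2; -Complex.I / 2, 0],
    !![0, -1 / 2; 1 / 2, 0],
    !![-Complex.I / 2, 0; 0, Complex.I / 2]]

theorem su2Gen_bracket (i j : Fin 3) :
    su2Gen i * su2Gen j - su2Gen j * su2Gen i = ∑ k, (eps i j k : ℂ) • su2Gen k := by
  ext a b
  fin_cases i <;> fin_cases j <;> fin_cases a <;> fin_cases b <;>
    simp [su2Gen, eps, Fin.sum_univ_three] <;> ring_nf <;> norm_num

/-- The element `a^i L_i` of `su(2)`. -/
noncomputable def su2Alg (a : Fin 3 → ℝ) : Matrix (Fin 2) (Fin 2) ℂ :=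
  ∑ i, (a i : ℂ) • su2Gen i

/-- The generators `L_{jk} = E_{kj} - E_{jk}` of `so(3)`. -/
def so3Gen (j k : Fin 3) : Matrix (Fin 3) (Fin 3) ℝ :=
  Matrix.single k j 1 - Matrix.single j k 1

/-- The matrix of `Ad u` on `su(2)` in the basis `L_i`; recall `tr (L_i L_j) = -δ_{ij} / 2`. -/
noncomputable def rotMatrix (u : SU2) : Matrix (Fin 3) (Fin 3) ℝ :=
  Matrix.of fun i j => -2 * (Matrix.trace (su2Gen i * (u.1 * su2Gen j * u.1ᴴ))).re

theorem su2_form (u : SU2) : ∃ a b c d : ℝ,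
    u.1 = !![⟨a, b⟩, ⟨-c, d⟩; ⟨c, d⟩, ⟨a, -b⟩] ∧ a ^ 2 + b ^ 2 + c ^ 2 + d ^ 2 = 1 := by
  have h1 : u.1ᴴ * u.1 = 1 := u.2.1.1
  have h1' : u.1 * u.1ᴴ = 1 := u.2.1.2
  have h2 : u.1.det = 1 := u.2.2
  have hadj : u.1ᴴ = u.1.adjugate := by
    have h3 : u.1 * u.1.adjugate = 1 := by rw [Matrix.mul_adjugate, h2, one_smul]
    calc u.1ᴴ = u.1ᴴ * (u.1 * u.1.adjugate) := by rw [h3, mul_one]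
      _ = u.1.adjugate := by rw [← mul_assoc, h1, one_mul]
  rw [Matrix.adjugate_fin_two] at hadj
  have e0 := congrFun (congrFun hadj 0) 0
  have e1 := congrFun (congrFun hadj 0) 1
  simp [Matrix.conjTranspose_apply] at e0 e1
  rw [Matrix.det_fin_two, ← e0] at h2
  have e2 : u.1 0 1 = - star (u.1 1 0) := by simp [e1]
  rw [e2] at h2
  refine ⟨(u.1 0 0).re, (u.1 0 0).im, (u.1 1 0).re, (u.1 1 0).im, ?_, ?_⟩
  · ext i j
    fin_cases i <;> fin_cases j <;> simp [Complex.ext_iff, e2, ← e0]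
  · have := congrArg Complex.re h2
    simp at this
    linarith

theorem rotMatrix_eq (u : SU2) (a b c d : ℝ)
    (h : u.1 = !![⟨a, b⟩, ⟨-c, d⟩; ⟨c, d⟩, ⟨a, -b⟩]) :
    rotMatrix u = !![a^2 - b^2 - c^2 + d^2, 2*a*b - 2*c*d, 2*a*c + 2*b*d;
      -2*a*b - 2*c*d, a^2 - b^2 + c^2 - d^2, 2*a*d - 2*b*c;
      -2*a*c + 2*b*d, -2*a*d - 2*b*c, a^2 + b^2 - c^2 - d^2] := by
  have hH : u.1ᴴ = !![⟨a, -b⟩, ⟨c, -d⟩; ⟨-c, -d⟩, ⟨a, b⟩] := by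
    rw [h]
    ext i j
    fin_cases i <;> fin_cases j <;> simp [Complex.ext_iff]
  ext i j
  rw [rotMatrix, hH, h]
  fin_cases i <;> fin_cases j <;>
    simp [su2Gen, Matrix.trace, Matrix.mul_apply, Fin.sum_univ_two] <;> ring

theorem rotMatrix_mul (u v : SU2) : rotMatrix (u * v) = rotMatrix u * rotMatrix v := by
  obtain ⟨a, b, c, d, hu, -⟩ := su2_form u
  obtain ⟨a', b', c', d', hv, -⟩ := su2_form v
  have huv : (u * v).1 = !![⟨a*a' - b*b' - c*c' - d*d', a*b' + b*a' - c*d' + d*c'⟩,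
      ⟨-(c*a' - d*b' + a*c' + b*d'), c*b' + d*a' + a*d' - b*c'⟩;
      ⟨c*a' - d*b' + a*c' + b*d', c*b' + d*a' + a*d' - b*c'⟩,
      ⟨a*a' - b*b' - c*c' - d*d', -(a*b' + b*a' - c*d' + d*c')⟩] := by
    show u.1 * v.1 = _
    rw [hu, hv]
    ext i j
    fin_cases i <;> fin_cases j <;>
      simp [Complex.ext_iff] <;> constructor <;> ring
  rw [rotMatrix_eq _ _ _ _ _ huv, rotMatrix_eq u a b c d hu, rotMatrix_eq v a' b' c' d' hv]
  ext i j
  fin_cases i <;> fin_cases j <;> simp [Matrix.mul_apply, Fin.sum_univ_three] <;> ring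

theorem rotMatrix_one : rotMatrix 1 = 1 := by
  rw [rotMatrix_eq 1 1 0 0 0]
  · ext i j
    fin_cases i <;> fin_cases j <;> simp
  · ext i j
    fin_cases i <;> fin_cases j <;> simp [Complex.ext_iff]

theorem rotMatrix_mem (u : SU2) : rotMatrix u ∈ SO3 := by
  obtain ⟨a, b, c, d, hu, h⟩ := su2_form u
  rw [Matrix.mem_specialOrthogonalGroup_iff, Matrix.mem_orthogonalGroup_iff,
    rotMatrix_eq u a b c d hu]
  have hd : d ^ 2 = 1 - a ^ 2 - b ^ 2 - c ^ 2 := by linarith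
  constructor
  · ext i j
    fin_cases i <;> fin_cases j <;> simp [Matrix.mul_apply, Fin.sum_univ_three] <;> grind
  · rw [Matrix.det_fin_three]
    simp
    have : (a ^ 2 + b ^ 2 + c ^ 2 + d ^ 2) ^ 3 = 1 := by rw [h]; norm_num
    rw [← this]; ring

/-- The homomorphism `Γ₁ : SU(2) → SO(3)` given by the adjoint action. -/
noncomputable def Gamma1 : SU2 →* SO3 where
  toFun u := ⟨rotMatrix u, rotMatrix_mem u⟩
  map_one' := Subtype.ext rotMatrix_one
  map_mul' u v := Subtype.ext (rotMatrix_mul u v)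

theorem Gamma1_adjoint (u : SU2) (j : Fin 3) :
    u.1 * su2Gen j * u.1ᴴ = ∑ i, ((Gamma1 u).1 i j : ℂ) • su2Gen i := by
  obtain ⟨a, b, c, d, hu, h⟩ := su2_form u
  have hH : u.1ᴴ = !![⟨a, -b⟩, ⟨c, -d⟩; ⟨-c, -d⟩, ⟨a, b⟩] := by
    rw [hu]
    ext i j
    fin_cases i <;> fin_cases j <;> simp [Complex.ext_iff]
  have hR : (Gamma1 u).1 = rotMatrix u := rfl
  rw [hR, rotMatrix_eq u a b c d hu, hH, hu]
  ext k l
  fin_cases j <;> fin_cases k <;> fin_cases l <;>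
    simp [su2Gen, Fin.sum_univ_three, Complex.ext_iff, -Complex.ofReal_pow, pow_two] <;>
    (constructor <;> ring)

/-! ### The Poincaré group `SU(2) ⋉ ℝ³` -/

/-- The group `ISO(3) = SU(2) ⋉ ℝ³`, where `SU(2)` acts on `ℝ³` by rotations through `Γ₁`. Its Lie
algebra is `[L_i, L_j] = ε_{ijk} L_k`, `[L_i, Q_j] = ε_{ijk} Q_k`, `[Q_i, Q_j] = 0`. -/
@[ext]
structure Poincare where
  rot : SU2
  trans : Fin 3 → ℝ

namespace Poincare

noncomputable instance : Mul Poincare :=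
  ⟨fun g h => ⟨g.rot * h.rot, g.trans + (Gamma1 g.rot).1 *ᵥ h.trans⟩⟩

instance : One Poincare := ⟨⟨1, 0⟩⟩

noncomputable instance : Inv Poincare :=
  ⟨fun g => ⟨g.rot⁻¹, -((Gamma1 g.rot⁻¹).1 *ᵥ g.trans)⟩⟩

theorem mul_def (g h : Poincare) :
    g * h = ⟨g.rot * h.rot, g.trans + (Gamma1 g.rot).1 *ᵥ h.trans⟩ := rfl

theorem one_def : (1 : Poincare) = ⟨1, 0⟩ := rfl

theorem inv_def (g : Poincare) : g⁻¹ = ⟨g.rot⁻¹, -((Gamma1 g.rot⁻¹).1 *ᵥ g.trans)⟩ := rfl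

noncomputable instance : Group Poincare :=
  Group.ofLeftAxioms
    (fun a b c => by
      simp [mul_def, mul_assoc, Matrix.mulVec_add, Matrix.mulVec_mulVec, add_assoc])
    (fun a => by simp [mul_def, one_def])
    (fun a => by simp [mul_def, one_def, inv_def])

noncomputable instance : TopologicalSpace Poincare :=
  TopologicalSpace.induced (fun g => (g.rot, g.trans)) inferInstance

/-- The embedding of the group as a closed submanifold of a vector space. -/
noncomputable def coords (g : Poincare) : (Fin 2 → Fin 2 → ℂ) × (Fin 3 → ℝ) := (fun a b => g.rot.1 a b, g.trans)

end Poincare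

/-- The embedding of `SO(3)` as a closed submanifold of a vector space. -/
noncomputable def SO3.coords (R : SO3) : Fin 3 → Fin 3 → ℝ := fun i j => R.1 i j

/-! ### Differential forms on a three-dimensional manifold -/

abbrev E3 := EuclideanSpace ℝ (Fin 3)

section Forms

variable {M : Type*} [TopologicalSpace M] [ChartedSpace E3 M]

variable (M) in
/-- Real differential 1-forms (no regularity imposed). -/
abbrev OneForm := ∀ x : M, TangentSpace (𝓡 3) x →L[ℝ] ℝ

variable (M) in
/-- Real bilinear forms on the tangent spaces, in which 2-forms are valued. -/
abbrev TwoForm := ∀ x : M, TangentSpace (𝓡 3) x → TangentSpace (𝓡 3) x → ℝ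

variable (M) in
/-- Smooth vector fields. -/
abbrev VectorField [IsManifold (𝓡 3) (⊤ : ℕ∞) M] :=
  ContMDiffSection (𝓡 3) E3 (⊤ : ℕ∞) (fun x : M => TangentSpace (𝓡 3) x)

def OneForm.SmoothOn [IsManifold (𝓡 3) (⊤ : ℕ∞) M] (β : OneForm M) (U : Set M) : Prop :=
  ContMDiffOn (𝓡 3) ((𝓡 3).prod 𝓘(ℝ, E3 →L[ℝ] ℝ)) (⊤ : ℕ∞)
    (fun x => (Bundle.TotalSpace.mk' (E3 →L[ℝ] ℝ) x (β x) :
      Bundle.TotalSpace (E3 →L[ℝ] ℝ) (fun x : M => TangentSpace (𝓡 3) x →L[ℝ] ℝ))) U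

/-- The differential of a function. -/
noncomputable def dFun (f : M → ℝ) : OneForm M := fun x => mfderiv (𝓡 3) 𝓘(ℝ, ℝ) f x

/-- The expression of a 1-form in the preferred chart at `x`, i.e. its pullback by the inverse of
that chart. -/
noncomputable def inChart (β : OneForm M) (x : M) : E3 → E3 →L[ℝ] ℝ := fun y =>
  (β ((extChartAt (𝓡 3) x).symm y)).comp
    (mfderiv 𝓘(ℝ, E3) (𝓡 3) (extChartAt (𝓡 3) x).symm y)

/-- The expression of a vector field in the preferred chart at `x`. -/
noncomputable def fieldInChart (X : ∀ x : M, TangentSpace (𝓡 3) x) (x : M) : E3 → E3 :=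
  VectorField.mpullback 𝓘(ℝ, E3) (𝓡 3) (extChartAt (𝓡 3) x).symm X

/-- The exterior derivative of a 1-form, `(dβ)_{μν} = ∂_μ β_ν - ∂_ν β_μ` in the preferred chart at
`x`. The tangent space at `x` is identified with the model space by this same chart. -/
noncomputable def extD (β : OneForm M) : TwoForm M := fun x u v =>
  fderiv ℝ (inChart β x) (extChartAt (𝓡 3) x x) u v
    - fderiv ℝ (inChart β x) (extChartAt (𝓡 3) x x) v u

/-- The Lie derivative of a 1-form, `(L_X β)_ν = X^μ ∂_μ β_ν + β_μ ∂_ν X^μ` in the preferred chart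
at `x`. -/
noncomputable def lieD (X : ∀ x : M, TangentSpace (𝓡 3) x) (β : OneForm M) : OneForm M := fun x =>
  fderiv ℝ (inChart β x) (extChartAt (𝓡 3) x x) (X x)
    + (inChart β x (extChartAt (𝓡 3) x x)).comp
        (fderiv ℝ (fieldInChart X x) (extChartAt (𝓡 3) x x))

/-- The interior derivative of a 1-form. -/
noncomputable def interior (X : ∀ x : M, TangentSpace (𝓡 3) x) (β : OneForm M) : M → ℝ := fun x => β x (X x)

/-- The exterior product of two 1-forms. -/
noncomputable def wedge (β γ : OneForm M) : TwoForm M := fun x u v => β x u * γ x v - β x v * γ x u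

/-- The exterior product of a 1-form and a 2-form. -/
noncomputable def wedge12 (β : OneForm M) (Ψ : TwoForm M) (x : M) (u v w : TangentSpace (𝓡 3) x) : ℝ :=
  β x u * Ψ x v w + β x v * Ψ x w u + β x w * Ψ x u v

/-! ### Gauge fields: curvature and infinitesimal gauge transformations -/

/-- The covariant derivative `Dζ^i = dζ^i + ε_{ijk} A^j ζ^k`. -/
noncomputable def covD (A : Fin 3 → OneForm M) (ζ : Fin 3 → M → ℝ) (i : Fin 3) : OneForm M :=
  fun x => dFun (ζ i) x + ∑ j, ∑ k, (eps i j k * ζ k x) • A j x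

/-- `F^i = dA^i + ½ ε_{ijk} A^j A^k`. -/
noncomputable def fieldF (A : Fin 3 → OneForm M) (i : Fin 3) : TwoForm M := fun x u v =>
  extD (A i) x u v + (1 / 2) * ∑ j, ∑ k, eps i j k * wedge (A j) (A k) x u v

/-- `Π^i = Dθ^i = dθ^i + ε_{ijk} A^j θ^k`. -/
noncomputable def fieldPi (A θ : Fin 3 → OneForm M) (i : Fin 3) : TwoForm M := fun x u v =>
  extD (θ i) x u v + ∑ j, ∑ k, eps i j k * wedge (A j) (θ k) x u v

/-- The `L`-component of the gauge transformation `δH = dϱ + [H, ϱ]`, where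
`H = A^i L_i + θ^i Q_i` and `ϱ = α^i L_i + ζ^i Q_i`. -/
noncomputable def deltaA (A : Fin 3 → OneForm M) (α : Fin 3 → M → ℝ) (i : Fin 3) : OneForm M :=
  covD A α i

/-- The `Q`-component of the gauge transformation `δH = dϱ + [H, ϱ]`. -/
noncomputable def deltaTheta (A θ : Fin 3 → OneForm M) (α ζ : Fin 3 → M → ℝ) (i : Fin 3) :
    OneForm M :=
  fun x => covD A ζ i x - ∑ j, ∑ k, (eps i j k * α j x) • θ k x

/-- `Ω^{ij} = dω^{ij} + ω^{ik} ω^{kj}`. -/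
noncomputable def curvature (w : Fin 3 → Fin 3 → OneForm M) (i j : Fin 3) : TwoForm M :=
  fun x u v => extD (w i j) x u v + ∑ k, wedge (w i k) (w k j) x u v

/-- `T^i = ∇e^i = de^i + ω^{ij} e^j`. -/
noncomputable def torsion (w : Fin 3 → Fin 3 → OneForm M) (e : Fin 3 → OneForm M) (i : Fin 3) :
    TwoForm M :=
  fun x u v => extD (e i) x u v + ∑ j, wedge (w i j) (e j) x u v

theorem extD_add (β : OneForm M) (x : M) (u u' v : TangentSpace (𝓡 3) x) :
    extD β x (u + u') v = extD β x u v + extD β x u' v := by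
  have h (a : E3 →L[ℝ] E3 →L[ℝ] ℝ) (p q r : E3) :
      a (p + q) r - a r (p + q) = (a p r - a r p) + (a q r - a r q) := by
    rw [map_add, map_add, add_apply]; ring
  exact h (fderiv ℝ (inChart β x) (extChartAt (𝓡 3) x x)) u u' v

theorem extD_smul (β : OneForm M) (x : M) (c : ℝ) (u v : TangentSpace (𝓡 3) x) :
    extD β x (c • u) v = c * extD β x u v := by
  have h (a : E3 →L[ℝ] E3 →L[ℝ] ℝ) (p r : E3) :
      a (c • p) r - a r (c • p) = c * (a p r - a r p) := by
    rw [map_smul, map_smul, smul_apply, smul_eq_mul, smul_eq_mul]; ring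
  exact h (fderiv ℝ (inChart β x) (extChartAt (𝓡 3) x x)) u v

theorem wedge_add (β γ : OneForm M) (x : M) (u u' v : TangentSpace (𝓡 3) x) :
    wedge β γ x (u + u') v = wedge β γ x u v + wedge β γ x u' v := by
  simp only [wedge, map_add]; ring

theorem wedge_smul (β γ : OneForm M) (x : M) (c : ℝ) (u v : TangentSpace (𝓡 3) x) :
    wedge β γ x (c • u) v = c * wedge β γ x u v := by
  simp only [wedge, map_smul, smul_eq_mul]; ring

theorem curvature_add (w : Fin 3 → Fin 3 → OneForm M) (i j : Fin 3) (x : M)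
    (u u' v : TangentSpace (𝓡 3) x) :
    curvature w i j x (u + u') v = curvature w i j x u v + curvature w i j x u' v := by
  simp only [curvature, extD_add, wedge_add, Finset.sum_add_distrib]; ring

theorem curvature_smul (w : Fin 3 → Fin 3 → OneForm M) (i j : Fin 3) (x : M) (c : ℝ)
    (u v : TangentSpace (𝓡 3) x) :
    curvature w i j x (c • u) v = c * curvature w i j x u v := by
  simp only [curvature, extD_smul, wedge_smul, ← Finset.mul_sum]; ring

theorem torsion_add (w : Fin 3 → Fin 3 → OneForm M) (e : Fin 3 → OneForm M) (i : Fin 3) (x : M)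
    (u u' v : TangentSpace (𝓡 3) x) :
    torsion w e i x (u + u') v = torsion w e i x u v + torsion w e i x u' v := by
  simp only [torsion, extD_add, wedge_add, Finset.sum_add_distrib]; ring

theorem torsion_smul (w : Fin 3 → Fin 3 → OneForm M) (e : Fin 3 → OneForm M) (i : Fin 3) (x : M)
    (c : ℝ) (u v : TangentSpace (𝓡 3) x) :
    torsion w e i x (c • u) v = c * torsion w e i x u v := by
  simp only [torsion, extD_smul, wedge_smul, ← Finset.mul_sum]; ring

/-- `δω^{ij} = ∇α^{ij} = dα^{ij} + ω^{ik} α^{kj} + ω^{jk} α^{ik}`. -/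
noncomputable def deltaOmega (w : Fin 3 → Fin 3 → OneForm M) (α : Fin 3 → Fin 3 → M → ℝ)
    (i j : Fin 3) : OneForm M :=
  fun x => dFun (α i j) x + ∑ k, (α k j x • w i k x + α i k x • w j k x)

/-- `δe^i = ∇ϑ^i - α^{ij} e^j`. -/
noncomputable def deltaE (w : Fin 3 → Fin 3 → OneForm M) (e : Fin 3 → OneForm M)
    (α : Fin 3 → Fin 3 → M → ℝ) (ϑ : Fin 3 → M → ℝ) (i : Fin 3) : OneForm M :=
  fun x => dFun (ϑ i) x + ∑ j, ϑ j x • w i j x - ∑ j, α i j x • e j x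

end Forms

/-! ### Principal bundles and connections -/

/-- A smooth principal `G`-bundle with total space `P` and base `M`: an open cover of `M` with
`G`-equivariant local trivializations over it and smooth transition functions. Here `coords` embeds
the Lie group `G` as a closed submanifold of the vector space `W`, and the smooth structure of `P`
is the one for which the local trivializations are diffeomorphisms. -/
structure PrincipalBundle (G : Type*) [Group G] [TopologicalSpace G]
    {W : Type*} [NormedAddCommGroup W] [NormedSpace ℝ W] (coords : G → W) (ι : Type*)
    (M : Type*) [TopologicalSpace M] [ChartedSpace E3 M]
    (P : Type*) [TopologicalSpace P] [MulAction Gᵐᵒᵖ P] where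
  proj : P → M
  triv : ι → Bundle.Trivialization G proj
  cover : ∀ x, ∃ a, x ∈ (triv a).baseSet
  equivariant : ∀ a p g, p ∈ (triv a).source →
    MulOpposite.op g • p ∈ (triv a).source ∧
      triv a (MulOpposite.op g • p) = ((triv a p).1, (triv a p).2 * g)
  smooth_transition : ∀ a b, ContMDiffOn (𝓡 3) 𝓘(ℝ, W) (⊤ : ℕ∞)
    (fun x => coords (triv a ((triv b).toOpenPartialHomeomorph.symm (x, 1))).2)
    ((triv a).baseSet ∩ (triv b).baseSet)

namespace PrincipalBundle

variable {G : Type*} [Group G] [TopologicalSpace G]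
  {W : Type*} [NormedAddCommGroup W] [NormedSpace ℝ W] {coords : G → W} {ι : Type*}
  {M : Type*} [TopologicalSpace M] [ChartedSpace E3 M]
  {P : Type*} [TopologicalSpace P] [MulAction Gᵐᵒᵖ P]

/-- The domain `U_a` of the trivialization with index `a`. -/
def domain (B : PrincipalBundle G coords ι M P) (a : ι) : Set M := (B.triv a).baseSet

/-- The local section over `U_a` given by the unit of the group. -/
def localSection (B : PrincipalBundle G coords ι M P) (a : ι) (x : M) : P :=
  (B.triv a).toOpenPartialHomeomorph.symm (x, 1)

/-- The transition function `t_{ab}`: `localSection b = localSection a · t_{ab}`. -/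
def transition (B : PrincipalBundle G coords ι M P) (a b : ι) (x : M) : G :=
  (B.triv a (B.localSection b x)).2

end PrincipalBundle

section Connections

variable {M : Type*} [TopologicalSpace M] [ChartedSpace E3 M] [IsManifold (𝓡 3) (⊤ : ℕ∞) M]
  {P : Type*} [TopologicalSpace P] {ι : Type*}

/-- A connection `H = A^i L_i + θ^i Q_i` on a principal bundle of the Poincaré group: the gauge
potentials of the local sections, with `H_b = t⁻¹ H_a t + t⁻¹ dt` where `t = (u, w)` is the
transition function from `a` to `b`. -/
structure PoincareConnection [MulAction Poincareᵐᵒᵖ P]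
    (B : PrincipalBundle Poincare Poincare.coords ι M P) where
  A : ι → Fin 3 → OneForm M
  θ : ι → Fin 3 → OneForm M
  smooth_A : ∀ a i, (A a i).SmoothOn (B.domain a)
  smooth_θ : ∀ a i, (θ a i).SmoothOn (B.domain a)
  transform_A : ∀ a b, ∀ x ∈ B.domain a ∩ B.domain b, ∀ v : TangentSpace (𝓡 3) x,
    su2Alg (fun i => A b i x v) =
      ((B.transition a b x).rot⁻¹).1 * su2Alg (fun i => A a i x v) * (B.transition a b x).rot.1
      + ((B.transition a b x).rot⁻¹).1 * Matrix.of (fun k l =>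
          (mfderiv (𝓡 3) 𝓘(ℝ, ℂ) (fun y => (B.transition a b y).rot.1 k l) x v : ℂ))
  transform_θ : ∀ a b, ∀ x ∈ B.domain a ∩ B.domain b, ∀ v : TangentSpace (𝓡 3) x,
    (fun i => θ b i x v) = (Gamma1 (B.transition a b x).rot⁻¹).1 *ᵥ
      (fun i => θ a i x v + covD (A a) (fun j y => (B.transition a b y).trans j) i x v)

/-- A connection on a principal bundle of `SO(3)`: antisymmetric potentials `ω^{ij}` with
`ω_b = R⁻¹ ω_a R + R⁻¹ dR` where `R` is the transition function from `a` to `b`. -/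
structure SO3Connection [MulAction SO3ᵐᵒᵖ P] (B : PrincipalBundle SO3 SO3.coords ι M P) where
  spin : ι → Fin 3 → Fin 3 → OneForm M
  smooth : ∀ a i j, (spin a i j).SmoothOn (B.domain a)
  antisymm : ∀ a i j, ∀ x ∈ B.domain a, spin a i j x = -spin a j i x
  transform : ∀ a b, ∀ x ∈ B.domain a ∩ B.domain b, ∀ v : TangentSpace (𝓡 3) x,
    Matrix.of (fun i j => spin b i j x v) =
      ((B.transition a b x)⁻¹).1 * Matrix.of (fun i j => spin a i j x v) * (B.transition a b x).1
      + ((B.transition a b x)⁻¹).1 * Matrix.of (fun i j =>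
          (mfderiv (𝓡 3) 𝓘(ℝ, ℝ) (fun y => (B.transition a b y).1 i j) x v : ℝ))

/-! ### The splitting of the gauge bundle -/

/-- A sub-bundle `P_A ⊆ P` whose structure group is the stability group `SU(2)`. Over `U_a` its
fibre at `x` is the left coset `(1, s_a(x)) SU(2)`, for a smooth function `s_a`. -/
structure StabilitySubbundle [MulAction Poincareᵐᵒᵖ P]
    (B : PrincipalBundle Poincare Poincare.coords ι M P) where
  carrier : Set P
  s : ι → M → Fin 3 → ℝ
  smooth : ∀ a, ContMDiffOn (𝓡 3) 𝓘(ℝ, Fin 3 → ℝ) (⊤ : ℕ∞) (s a) (B.domain a)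
  mem_iff : ∀ a, ∀ p ∈ (B.triv a).source,
    p ∈ carrier ↔ (B.triv a p).2.trans = s a (B.proj p)

/-- The coset part `θ` of the connection `H` restricted to the sub-bundle `P_A`, in the local
section `localSection a · (1, s_a)` of `P_A`. The stability part `A` in this section is the one in
`localSection a`. -/
noncomputable def StabilitySubbundle.theta [MulAction Poincareᵐᵒᵖ P]
    {B : PrincipalBundle Poincare Poincare.coords ι M P} (Q : StabilitySubbundle B)
    (H : PoincareConnection B) (a : ι) (i : Fin 3) : OneForm M :=
  fun x => H.θ a i x + covD (H.A a) (fun j y => Q.s a y j) i x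

/-- The parameters `ζ` of gauge transformations in the `ℝ³` sector: smooth equivariant functions
`P → ℝ³`, i.e. sections of the associated vector bundle. -/
def translationParameters [MulAction Poincareᵐᵒᵖ P]
    (B : PrincipalBundle Poincare Poincare.coords ι M P) : Submodule ℝ (P → Fin 3 → ℝ) where
  carrier := {ζ | (∀ p (g : Poincare), ζ (MulOpposite.op g • p) = (Gamma1 g.rot⁻¹).1 *ᵥ ζ p) ∧
    ∀ a, ContMDiffOn (𝓡 3) 𝓘(ℝ, Fin 3 → ℝ) (⊤ : ℕ∞) (fun x => ζ (B.localSection a x)) (B.domain a)}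
  add_mem' := fun {f g} hf hg =>
    ⟨fun p r => by simp only [Pi.add_apply, hf.1, hg.1, Matrix.mulVec_add],
      fun a => (hf.2 a).add (hg.2 a)⟩
  zero_mem' := ⟨fun p r => by simp, fun a => contMDiffOn_const⟩
  smul_mem' := fun c f hf =>
    ⟨fun p r => by simp only [Pi.smul_apply, hf.1, Matrix.mulVec_smul],
      fun a => by
        have h : ContMDiffOn (𝓡 3) 𝓘(ℝ, ℝ) (⊤ : ℕ∞) (fun _ : M => c) (B.domain a) := contMDiffOn_const
        exact h.smul (hf.2 a)⟩

end Connections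

/-! ### The coframe bundle -/

/-- An oriented Riemannian metric on `M`. The orientation is continuous: near every point it is
induced by a smooth local coframe. -/
structure OrientedMetric (M : Type*) [TopologicalSpace M] [ChartedSpace E3 M]
    [IsManifold (𝓡 3) (⊤ : ℕ∞) M] where
  metric : Bundle.ContMDiffRiemannianMetric (𝓡 3) (⊤ : ℕ∞) E3 (fun x : M => TangentSpace (𝓡 3) x)
  orient : ∀ x : M, Orientation ℝ (TangentSpace (𝓡 3) x) (Fin 3)
  continuous_orient : ∀ x₀ : M, ∃ U, IsOpen U ∧ x₀ ∈ U ∧ ∃ e : Fin 3 → OneForm M,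
    (∀ i, (e i).SmoothOn U) ∧ ∀ x ∈ U, ∃ c : TangentSpace (𝓡 3) x ≃L[ℝ] (Fin 3 → ℝ),
      (∀ v i, c v i = e i x v) ∧
        Orientation.map (Fin 3) c.toLinearEquiv (orient x) = (Pi.basisFun ℝ (Fin 3)).orientation

/-- The linear action of a rotation. -/
noncomputable def so3Equiv (R : SO3) : (Fin 3 → ℝ) ≃L[ℝ] (Fin 3 → ℝ) :=
  LinearEquiv.toContinuousLinearEquiv
    { R.1.mulVecLin with
      invFun := fun v => (R⁻¹).1 *ᵥ v
      left_inv := fun v => by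
        have h : (R⁻¹).1 * R.1 = 1 := congrArg Subtype.val (inv_mul_cancel R)
        simp [Matrix.mulVec_mulVec, h]
      right_inv := fun v => by
        have h : R.1 * (R⁻¹).1 = 1 := congrArg Subtype.val (mul_inv_cancel R)
        simp [Matrix.mulVec_mulVec, h] }

theorem so3Equiv_apply (R : SO3) (v : Fin 3 → ℝ) : so3Equiv R v = R.1 *ᵥ v := rfl

theorem so3Equiv_dot (R : SO3) (v w : Fin 3 → ℝ) :
    ∑ i, so3Equiv R v i * so3Equiv R w i = ∑ i, v i * w i := by
  have h : R.1ᵀ * R.1 = 1 := (Matrix.mem_orthogonalGroup_iff' (Fin 3) ℝ).1 R.2.1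
  change (R.1 *ᵥ v) ⬝ᵥ (R.1 *ᵥ w) = v ⬝ᵥ w
  rw [Matrix.dotProduct_mulVec, ← Matrix.mulVec_transpose, Matrix.mulVec_mulVec, h,
    Matrix.one_mulVec]

theorem so3Equiv_orientation (R : SO3) (o : Orientation ℝ (Fin 3 → ℝ) (Fin 3)) :
    Orientation.map (Fin 3) (so3Equiv R).toLinearEquiv o = o := by
  rw [Orientation.map_eq_iff_det_pos _ _ (by simp)]
  have h : ((so3Equiv R).toLinearEquiv : (Fin 3 → ℝ) →ₗ[ℝ] (Fin 3 → ℝ)) = Matrix.toLin' R.1 := rfl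
  have hd : R.1.det = 1 := R.2.2
  rw [h, LinearMap.det_toLin', hd]
  exact one_pos

theorem orientation_map_trans {V : Type*} [AddCommGroup V] [Module ℝ V] [TopologicalSpace V]
    (f : V ≃L[ℝ] (Fin 3 → ℝ)) (g : (Fin 3 → ℝ) ≃L[ℝ] (Fin 3 → ℝ)) (o : Orientation ℝ V (Fin 3)) :
    Orientation.map (Fin 3) (f.trans g).toLinearEquiv o
      = Orientation.map (Fin 3) g.toLinearEquiv (Orientation.map (Fin 3) f.toLinearEquiv o) := by
  induction o using Module.Ray.ind with
  | h v hv => rfl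

section Coframe

variable {M : Type*} [TopologicalSpace M] [ChartedSpace E3 M] [IsManifold (𝓡 3) (⊤ : ℕ∞) M]

/-- The total space of the coframe bundle: oriented orthonormal coframes `(e^i)` of the cotangent
spaces, written as linear isomorphisms `v ↦ (e^i(v))` from the tangent spaces to `ℝ³`. -/
structure Coframe (N : OrientedMetric M) where
  base : M
  frame : TangentSpace (𝓡 3) base ≃L[ℝ] (Fin 3 → ℝ)
  orthonormal : ∀ v w, N.metric.inner base v w = ∑ i, frame v i * frame w i
  oriented : Orientation.map (Fin 3) frame.toLinearEquiv (N.orient base)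
    = (Pi.basisFun ℝ (Fin 3)).orientation

namespace Coframe

theorem ext_frame {N : OrientedMetric M} {c c' : Coframe N} (h : c.base = c'.base)
    (h' : ∀ v : E3, c.frame v = c'.frame v) : c = c' := by
  obtain ⟨x, f, _, _⟩ := c
  obtain ⟨y, f', _, _⟩ := c'
  obtain rfl : x = y := h
  obtain rfl : f = f' := ContinuousLinearEquiv.ext (funext h')
  rfl

/-- The topology induced by the vector bundle `Hom(TM, ℝ³)`. -/
noncomputable instance (N : OrientedMetric M) : TopologicalSpace (Coframe N) :=
  TopologicalSpace.induced
    (fun c => (Bundle.TotalSpace.mk' (E3 →L[ℝ] (Fin 3 → ℝ)) c.base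
        (c.frame : TangentSpace (𝓡 3) c.base →L[ℝ] (Fin 3 → ℝ)) :
      Bundle.TotalSpace (E3 →L[ℝ] (Fin 3 → ℝ))
        (fun x : M => TangentSpace (𝓡 3) x →L[ℝ] (Fin 3 → ℝ))))
    inferInstance

/-- The right action of `SO(3)`: the coframe `e` is sent to `R⁻¹ e`. -/
noncomputable instance (N : OrientedMetric M) : MulAction SO3ᵐᵒᵖ (Coframe N) where
  smul R c :=
    { base := c.base
      frame := c.frame.trans (so3Equiv (MulOpposite.unop R)⁻¹)
      orthonormal := fun v w => by
        rw [c.orthonormal]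
        exact (so3Equiv_dot _ _ _).symm
      oriented := by
        have h := so3Equiv_orientation (MulOpposite.unop R)⁻¹
          (Pi.basisFun ℝ (Fin 3)).orientation
        rw [← c.oriented] at h
        rw [← c.oriented]
        rw [orientation_map_trans]
        exact h }
  one_smul c := by
    refine Coframe.ext_frame rfl fun v => ?_
    change so3Equiv (MulOpposite.unop 1)⁻¹ (c.frame v) = c.frame v
    simp [so3Equiv_apply]
  mul_smul R S c := by
    refine Coframe.ext_frame rfl fun v => ?_
    change so3Equiv (MulOpposite.unop (R * S))⁻¹ (c.frame v)
      = so3Equiv (MulOpposite.unop R)⁻¹ (so3Equiv (MulOpposite.unop S)⁻¹ (c.frame v))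
    simp [so3Equiv_apply, Matrix.mulVec_mulVec]

end Coframe

/-- A coframe bundle `P' = (SO(3), M', ω, e)` of a Riemann-Cartan manifold `M'`: an oriented
Riemannian metric, the principal `SO(3)`-bundle of its coframes, a spin connection `ω`, and the
soldering form `e`. The latter is the tautological one: over `U_a` it is the coframe field which
the trivialization sends to the unit of `SO(3)`. -/
structure CoframeBundle (ι : Type*) (M : Type*) [TopologicalSpace M] [ChartedSpace E3 M]
    [IsManifold (𝓡 3) (⊤ : ℕ∞) M] where
  geometry : OrientedMetric M
  bundle : PrincipalBundle SO3 SO3.coords ι M (Coframe geometry)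
  proj_eq : ∀ c, bundle.proj c = c.base
  connection : SO3Connection bundle
  e : ι → Fin 3 → OneForm M
  smooth_e : ∀ a i, (e a i).SmoothOn (bundle.domain a)
  soldering : ∀ a, ∀ c ∈ (bundle.triv a).source, ∀ v i,
    e a i c.base v = ((bundle.triv a c).2.1 *ᵥ c.frame v) i

namespace CoframeBundle

variable {ι : Type*}

/-- The spin connection. -/
def spin (C : CoframeBundle ι M) : ι → Fin 3 → Fin 3 → OneForm M := C.connection.spin

/-- The curvature 2-form `Ω`. -/
noncomputable def Omega (C : CoframeBundle ι M) (a : ι) : Fin 3 → Fin 3 → TwoForm M :=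
  curvature (C.spin a)

/-- The torsion 2-form `T`. -/
noncomputable def Tor (C : CoframeBundle ι M) (a : ι) : Fin 3 → TwoForm M :=
  torsion (C.spin a) (C.e a)

/-- The space of tangent vectors `v` at `x` with `i_v Ω = 0` and `i_v T = 0`. -/
noncomputable def residualAt (C : CoframeBundle ι M) (x : M) :
    Submodule ℝ (TangentSpace (𝓡 3) x) where
  carrier := {u | ∀ a, x ∈ C.bundle.domain a → ∀ v,
    (∀ i j, C.Omega a i j x u v = 0) ∧ ∀ i, C.Tor a i x u v = 0}
  add_mem' := fun {u u'} hu hu' a ha v =>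
    ⟨fun i j => by
        rw [Omega, curvature_add, ← Omega, (hu a ha v).1 i j, (hu' a ha v).1 i j, add_zero],
      fun i => by
        rw [Tor, torsion_add, ← Tor, (hu a ha v).2 i, (hu' a ha v).2 i, add_zero]⟩
  zero_mem' := fun a _ v =>
    ⟨fun i j => by
        have h := curvature_smul (C.spin a) i j x 0 0 v
        rwa [zero_smul, zero_mul] at h,
      fun i => by
        have h := torsion_smul (C.spin a) (C.e a) i x 0 0 v
        rwa [zero_smul, zero_mul] at h⟩
  smul_mem' := fun c u hu a ha v =>
    ⟨fun i j => by rw [Omega, curvature_smul, ← Omega, (hu a ha v).1 i j, mul_zero],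
      fun i => by rw [Tor, torsion_smul, ← Tor, (hu a ha v).2 i, mul_zero]⟩

/-- `Diff(D)_X`: the (infinitesimal) diffeomorphisms which survive the constraints, i.e. the smooth
vector fields `X` with `i_X Ω = 0` and `i_X T = 0`. -/
noncomputable def DiffX (C : CoframeBundle ι M) : Submodule ℝ (VectorField M) where
  carrier := {X | ∀ x, X x ∈ C.residualAt x}
  add_mem' := fun hX hY x => (C.residualAt x).add_mem (hX x) (hY x)
  zero_mem' := fun x => (C.residualAt x).zero_mem
  smul_mem' := fun c _ hX x => (C.residualAt x).smul_mem c (hX x)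

end CoframeBundle

end Coframe

end GaugeGravity

/-!
A splitting of the Poincaré bundle turns the gauge fields into a coframe and a spin connection.

* The entries of `Γ₁(u)` are quadratic polynomials in the quaternion `u`. A rotation of angle less
  than `π` is the image of an explicit quaternion, and every rotation becomes one of these after a
  rotation by `π` about a coordinate axis (`surjective_Gamma1`). Along a curve with `du = u b - a u`,
  the rotations `R = Γ₁(u)` satisfy `dR = R ad(b) - ad(a) R` (`hasDerivAt_Gamma1_of_eq`).
* A reduction of `P` to `SU(2)` is a section of `P / SU(2)`, a bundle of affine spaces `ℝ³` with affine
  transition functions, so that local sections can be averaged with a partition of unity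
  (`nonempty_stabilitySubbundle`).
* Two local sections of the reduction differ by an element of `SU(2)` only. Hence the coset field `θ`
  has no inhomogeneous term in its transformation law (`StabilitySubbundle.theta_transform`), and if
  it is nondegenerate then `e = μ⁻¹ θ` is a family of local coframes related by rotations. These are
  the oriented orthonormal frames of a metric, and they trivialize its coframe bundle
  (`CoframeAtlas.bundle`). The derivative of `Γ₁` shows that `ω^{ij} = -ε^{ijk} A_k`, the image of `A`
  under the adjoint representation, is a connection on this bundle
  (`PoincareConnection.spinForm_transform`).
* The map `f` sends the point with coordinates `(u, w)` to the coframe `Γ₁(u)⁻¹ e`. The identities for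
  curvature, torsion, Lagrangians and gauge transformations are pointwise algebra with the
  Levi-Civita symbol. Gauge parameters in `ℝ³` are the components of vector fields in the coframes
  `f p` (`StabilitySubbundle.parameterEquiv`).
* Cartan's formula `L_X = i_X d + d i_X` (`lieD_eq`) identifies the failure of the diffeomorphism
  generated by `X` to be a gauge transformation with `i_X Ω` and `i_X T`
  (`CoframeBundle.mem_DiffX_iff`). A bump function extends each tangent vector to a vector field, so
  that this failure vanishes for all `X` only if `Ω` and `T` do.
-/

namespace GaugeGravity

/-! ### The covering homomorphism and its differential -/

theorem rotMatrix_apply (u : SU2) (i j : Fin 3) :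
    rotMatrix u i j = -2 * (∑ a, ∑ b, su2Gen i a b *
      ∑ d, (∑ c, u.1 b c * su2Gen j c d) * star (u.1 a d)).re := by
  simp [rotMatrix, Matrix.trace, Matrix.mul_apply, Matrix.conjTranspose_apply]

theorem continuous_Gamma1 : Continuous Gamma1 := by
  have hc (k l : Fin 2) : Continuous fun u : SU2 => u.1 k l :=
    (continuous_apply l).comp ((continuous_apply k).comp continuous_subtype_val)
  refine Continuous.subtype_mk (continuous_matrix fun i j => ?_) _
  simp only [rotMatrix_apply]
  refine continuous_const.mul (Complex.continuous_re.comp ?_)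
  refine continuous_finsetSum _ fun a _ => continuous_finsetSum _ fun b _ =>
    continuous_const.mul (continuous_finsetSum _ fun d _ => Continuous.mul ?_ (hc a d).star)
  exact continuous_finsetSum _ fun c _ => (hc b c).mul continuous_const

theorem Gamma1_eq_one_iff (u : SU2) : Gamma1 u = 1 ↔ u.1 = 1 ∨ u.1 = -1 := by
  obtain ⟨a, b, c, d, hu, h⟩ := su2_form u
  have hone : Gamma1 u = 1 ↔ rotMatrix u = 1 := by
    rw [Subtype.ext_iff]; rfl
  rw [hone, rotMatrix_eq u a b c d hu, hu]
  constructor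
  · intro hR
    have h0 := congrFun (congrFun hR 0) 0
    have h1 := congrFun (congrFun hR 1) 1
    have h2 := congrFun (congrFun hR 2) 2
    simp at h0 h1 h2
    have ha : a ^ 2 = 1 := by linarith
    have hb : b = 0 := by nlinarith
    have hc : c = 0 := by nlinarith
    have hd : d = 0 := by nlinarith
    subst hb hc hd
    rcases sq_eq_one_iff.1 ha with rfl | rfl
    · left; ext i j; fin_cases i <;> fin_cases j <;> simp [Complex.ext_iff]
    · right; ext i j; fin_cases i <;> fin_cases j <;> simp [Complex.ext_iff]
  · rintro (hm | hm)
    all_goals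
      have h0 := congrFun (congrFun hm 0) 0
      have h1 := congrFun (congrFun hm 1) 0
      simp [Complex.ext_iff] at h0 h1
      obtain ⟨rfl, rfl⟩ := h0
      obtain ⟨rfl, rfl⟩ := h1
      ext i j; fin_cases i <;> fin_cases j <;> simp

/-- The element of `SU(2)` which corresponds to a unit quaternion. -/
def quaternionSU2 (a b c d : ℝ) (h : a ^ 2 + b ^ 2 + c ^ 2 + d ^ 2 = 1) : SU2 :=
  ⟨!![⟨a, b⟩, ⟨-c, d⟩; ⟨c, d⟩, ⟨a, -b⟩], by
    rw [Matrix.mem_specialUnitaryGroup_iff, Matrix.mem_unitaryGroup_iff]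
    constructor
    · ext i j
      fin_cases i <;> fin_cases j <;>
        simp [Matrix.mul_apply, Fin.sum_univ_two, Matrix.star_apply, Complex.ext_iff] <;>
        constructor <;> linarith
    · rw [Matrix.det_fin_two]
      simp [Complex.ext_iff]
      constructor <;> linarith⟩

theorem Gamma1_quaternionSU2 (a b c d : ℝ) (h : a ^ 2 + b ^ 2 + c ^ 2 + d ^ 2 = 1) :
    (Gamma1 (quaternionSU2 a b c d h)).1 =
      !![a^2 - b^2 - c^2 + d^2, 2*a*b - 2*c*d, 2*a*c + 2*b*d;
      -2*a*b - 2*c*d, a^2 - b^2 + c^2 - d^2, 2*a*d - 2*b*c;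
      -2*a*c + 2*b*d, -2*a*d - 2*b*c, a^2 + b^2 - c^2 - d^2] :=
  rotMatrix_eq _ a b c d rfl

/-- A rotation whose angle is less than `π` is the image of the quaternion with positive real part
given by its trace and its antisymmetric part. -/
theorem exists_Gamma1_eq_of_trace (R : SO3) (ht : 0 < 1 + R.1.trace) : ∃ u, Gamma1 u = R := by
  have h1 : R.1 * R.1ᵀ = 1 := (Matrix.mem_orthogonalGroup_iff (Fin 3) ℝ).1 R.2.1
  have h2 : R.1ᵀ * R.1 = 1 := (Matrix.mem_orthogonalGroup_iff' (Fin 3) ℝ).1 R.2.1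
  have hd : R.1.det = 1 := R.2.2
  have hadj : R.1.adjugate = R.1ᵀ := by
    calc R.1.adjugate = (R.1ᵀ * R.1) * R.1.adjugate := by rw [h2, one_mul]
      _ = R.1ᵀ := by rw [mul_assoc, Matrix.mul_adjugate, hd, one_smul, mul_one]
  -- As the adjugate of `R` is its transpose, each entry of `R` equals its cofactor: with the
  -- orthogonality relations, this makes the products of two of `a, b, c, d` affine in the entries.
  obtain ⟨S, hS⟩ := R
  simp only at h1 h2 hd hadj ht
  have e1 (i j : Fin 3) := congrFun (congrFun h1 i) j
  have e2 (i j : Fin 3) := congrFun (congrFun h2 i) j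
  have e3 (i j : Fin 3) := congrFun (congrFun hadj i) j
  simp only [Matrix.mul_apply, Fin.sum_univ_three, Matrix.transpose_apply] at e1 e2
  rw [Matrix.adjugate_fin_three] at e3
  simp only [Matrix.trace, Fin.sum_univ_three, Matrix.diag_apply] at ht
  set a := √(1 + (S 0 0 + S 1 1 + S 2 2)) / 2 with ha
  have ha0 : 0 < a := by positivity
  have ha2 : 4 * a ^ 2 = 1 + (S 0 0 + S 1 1 + S 2 2) := by
    rw [ha, div_pow, Real.sq_sqrt ht.le]; ring
  have hne : a ≠ 0 := ha0.ne'
  have f00 := e3 0 0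
  have f01 := e3 0 1
  have f02 := e3 0 2
  have f10 := e3 1 0
  have f11 := e3 1 1
  have f12 := e3 1 2
  have f20 := e3 2 0
  have f21 := e3 2 1
  have f22 := e3 2 2
  have g0 := e1 0 0
  have g1 := e1 1 1
  have g2 := e1 2 2
  have k0 := e2 0 0
  have k1 := e2 1 1
  have k2 := e2 2 2
  have l1 := e1 0 1
  have l2 := e1 0 2
  have l3 := e1 1 2
  have m1 := e2 0 1
  have m2 := e2 0 2
  have m3 := e2 1 2
  clear e1 e2 e3
  simp at f00 f01 f02 f10 f11 f12 f20 f21 f22 g0 g1 g2 k0 k1 k2 l1 l2 l3 m1 m2 m3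
  obtain ⟨b, hb⟩ : ∃ b, b = (S 0 1 - S 1 0) / (4 * a) := ⟨_, rfl⟩
  obtain ⟨c, hc⟩ : ∃ c, c = (S 0 2 - S 2 0) / (4 * a) := ⟨_, rfl⟩
  obtain ⟨d, hd'⟩ : ∃ d, d = (S 1 2 - S 2 1) / (4 * a) := ⟨_, rfl⟩
  rw [eq_div_iff (by positivity)] at hb hc hd'
  have hcan {x y : ℝ} (h : 4 * a ^ 2 * x = 4 * a ^ 2 * y) : x = y :=
    mul_left_cancel₀ (by positivity) h
  have hb2 : 4 * b ^ 2 = 1 - S 0 0 - S 1 1 + S 2 2 := by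
    apply hcan
    have : 4 * a ^ 2 * (4 * b ^ 2) = (S 0 1 - S 1 0) ^ 2 := by rw [← hb]; ring
    rw [this, ha2]
    linarith
  have hc2 : 4 * c ^ 2 = 1 - S 0 0 + S 1 1 - S 2 2 := by
    apply hcan
    have : 4 * a ^ 2 * (4 * c ^ 2) = (S 0 2 - S 2 0) ^ 2 := by rw [← hc]; ring
    rw [this, ha2]
    linarith
  have hd2 : 4 * d ^ 2 = 1 + S 0 0 - S 1 1 - S 2 2 := by
    apply hcan
    have : 4 * a ^ 2 * (4 * d ^ 2) = (S 1 2 - S 2 1) ^ 2 := by rw [← hd']; ring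
    rw [this, ha2]
    linarith
  have hcd : 4 * (c * d) = -(S 0 1 + S 1 0) := by
    apply hcan
    have : 4 * a ^ 2 * (4 * (c * d)) = (S 0 2 - S 2 0) * (S 1 2 - S 2 1) := by
      rw [← hc, ← hd']; ring
    rw [this, ha2]
    linarith
  have hbd : 4 * (b * d) = S 0 2 + S 2 0 := by
    apply hcan
    have : 4 * a ^ 2 * (4 * (b * d)) = (S 0 1 - S 1 0) * (S 1 2 - S 2 1) := by
      rw [← hb, ← hd']; ring
    rw [this, ha2]
    linarith
  have hbc : 4 * (b * c) = -(S 1 2 + S 2 1) := by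
    apply hcan
    have : 4 * a ^ 2 * (4 * (b * c)) = (S 0 1 - S 1 0) * (S 0 2 - S 2 0) := by
      rw [← hb, ← hc]; ring
    rw [this, ha2]
    linarith
  refine ⟨quaternionSU2 a b c d (by linarith), Subtype.ext ?_⟩
  rw [Gamma1_quaternionSU2]
  ext i j
  fin_cases i <;> fin_cases j <;> simp <;> linarith

theorem surjective_Gamma1 : Function.Surjective Gamma1 := by
  intro R
  -- Up to a rotation by `π` about a coordinate axis, the angle of `R` is less than `π`: the four
  -- traces below add up to zero.
  by_contra hR
  have key (u : SU2) : 1 + (R * Gamma1 u).1.trace ≤ 0 := by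
    by_contra! h
    obtain ⟨v, hv⟩ := exists_Gamma1_eq_of_trace _ h
    exact hR ⟨v * u⁻¹, by rw [map_mul, hv, map_inv, mul_inv_cancel_right]⟩
  have k0 := key (quaternionSU2 1 0 0 0 (by norm_num))
  have k1 := key (quaternionSU2 0 1 0 0 (by norm_num))
  have k2 := key (quaternionSU2 0 0 1 0 (by norm_num))
  have k3 := key (quaternionSU2 0 0 0 1 (by norm_num))
  simp [Gamma1_quaternionSU2, Matrix.trace, Fin.sum_univ_three, Matrix.mul_apply] at k0 k1 k2 k3
  linarith

/-- The matrix of `ad (a^k L_k)` on `su(2)` in the basis `L_i`. -/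
noncomputable def adMatrix (a : Fin 3 → ℝ) : Matrix (Fin 3) (Fin 3) ℝ :=
  Matrix.of fun i j => -∑ k, eps i j k * a k

theorem adMatrix_apply (a : Fin 3 → ℝ) (i j : Fin 3) :
    adMatrix a i j = -∑ k, eps i j k * a k := rfl

/-- The differential of `Γ₁` at the unit sends `L_k` to `½ ε_{kpq} L_{pq}`. -/
theorem adMatrix_eq_sum_so3Gen (a : Fin 3 → ℝ) :
    adMatrix a = ∑ k, a k • ((1 / 2 : ℝ) • ∑ p, ∑ q, eps k p q • so3Gen p q) := by
  ext i j
  fin_cases i <;> fin_cases j <;>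
    simp [adMatrix, Fin.sum_univ_three, eps, so3Gen, Matrix.single] <;> ring

theorem su2Alg_bracket (a : Fin 3 → ℝ) (j : Fin 3) :
    su2Alg a * su2Gen j - su2Gen j * su2Alg a = ∑ i, (adMatrix a i j : ℂ) • su2Gen i := by
  have h : su2Alg a * su2Gen j - su2Gen j * su2Alg a =
      ∑ i, (a i : ℂ) • (su2Gen i * su2Gen j - su2Gen j * su2Gen i) := by
    simp only [su2Alg, Finset.sum_mul, Finset.mul_sum, Matrix.smul_mul, Matrix.mul_smul, smul_sub,
      Finset.sum_sub_distrib]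
  rw [h]
  simp only [su2Gen_bracket, adMatrix_apply]
  fin_cases j <;> simp [Fin.sum_univ_three, eps, smul_smul] <;> module

theorem su2Alg_conjTranspose (a : Fin 3 → ℝ) : (su2Alg a)ᴴ = -su2Alg a := by
  ext i j
  fin_cases i <;> fin_cases j <;>
    simp [su2Alg, su2Gen, Fin.sum_univ_three, Complex.ext_iff] <;> ring_nf <;> simp

/-- The coefficient of `L_i` in an element of `su(2)`. -/
noncomputable def su2Coeff (i : Fin 3) : Matrix (Fin 2) (Fin 2) ℂ →ₗ[ℝ] ℝ where
  toFun m := -2 * (Matrix.trace (su2Gen i * m)).re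
  map_add' m n := by simp [mul_add]
  map_smul' c m := by simp; ring

theorem su2Coeff_sum (c : Fin 3 → ℝ) (i : Fin 3) :
    su2Coeff i (∑ k, (c k : ℂ) • su2Gen k) = c i := by
  fin_cases i <;>
    simp [su2Coeff, su2Gen, Fin.sum_univ_three, Matrix.trace] <;> ring

/-- `Γ₁(u)` is the matrix of `Ad u`, on elements of `su(2)`. -/
theorem su2Coeff_conj_sum (u : SU2) (c : Fin 3 → ℝ) (i : Fin 3) :
    su2Coeff i (u.1 * (∑ k, (c k : ℂ) • su2Gen k) * u.1ᴴ) = ((Gamma1 u).1 *ᵥ c) i := by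
  have h : u.1 * (∑ k, (c k : ℂ) • su2Gen k) * u.1ᴴ =
      ∑ k, c k • (u.1 * su2Gen k * u.1ᴴ) := by
    simp only [Finset.mul_sum, Finset.sum_mul, Matrix.mul_smul, Matrix.smul_mul]
    rfl
  rw [h, map_sum]
  simp only [map_smul, smul_eq_mul, Matrix.mulVec, dotProduct]
  exact Finset.sum_congr rfl fun k _ => mul_comm _ _

/-- The matrix of `ad a ∘ Ad u`. -/
theorem su2Coeff_sum_conj (u : SU2) (a : Fin 3 → ℝ) (i j : Fin 3) :
    su2Coeff i (su2Alg a * (u.1 * su2Gen j * u.1ᴴ) - (u.1 * su2Gen j * u.1ᴴ) * su2Alg a) =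
      (adMatrix a * (Gamma1 u).1) i j := by
  have h : su2Alg a * (u.1 * su2Gen j * u.1ᴴ) - (u.1 * su2Gen j * u.1ᴴ) * su2Alg a =
      ∑ k, (Gamma1 u).1 k j • (su2Alg a * su2Gen k - su2Gen k * su2Alg a) := by
    rw [Gamma1_adjoint]
    simp only [Finset.mul_sum, Finset.sum_mul, Matrix.mul_smul, Matrix.smul_mul, smul_sub,
      Finset.sum_sub_distrib]
    rfl
  rw [h, map_sum]
  simp only [map_smul, smul_eq_mul, su2Alg_bracket, su2Coeff_sum, Matrix.mul_apply]
  exact Finset.sum_congr rfl fun k _ => mul_comm _ _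

/-- The derivative of `Γ₁` along a curve. -/
theorem hasDerivAt_Gamma1 {γ : ℝ → SU2} {t : ℝ} {m : Matrix (Fin 2) (Fin 2) ℂ}
    (h : ∀ k l, HasDerivAt (fun s => (γ s).1 k l) (m k l) t) (i j : Fin 3) :
    HasDerivAt (fun s => (Gamma1 (γ s)).1 i j)
      (su2Coeff i (m * su2Gen j * (γ t).1ᴴ + (γ t).1 * su2Gen j * mᴴ)) t := by
  have h' (k l : Fin 2) : HasDerivAt (fun s => star ((γ s).1 k l)) (star (m k l)) t := (h k l).star
  have h1 : HasDerivAt (fun s => ∑ a, ∑ b, su2Gen i a b *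
      ∑ d, (∑ c, (γ s).1 b c * su2Gen j c d) * star ((γ s).1 a d))
      (∑ a, ∑ b, su2Gen i a b * ∑ d, ((∑ c, m b c * su2Gen j c d) * star ((γ t).1 a d)
        + (∑ c, (γ t).1 b c * su2Gen j c d) * star (m a d))) t := by
    refine HasDerivAt.fun_sum fun a _ => HasDerivAt.fun_sum fun b _ =>
      HasDerivAt.const_mul _ (HasDerivAt.fun_sum fun d _ => HasDerivAt.mul ?_ (h' a d))
    exact HasDerivAt.fun_sum fun c _ => (h b c).mul_const _
  have h2 := ((Complex.reCLM.hasFDerivAt.comp_hasDerivAt t h1).const_mul (-2 : ℝ))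
  have e : (fun s => (Gamma1 (γ s)).1 i j) = fun y => -2 * (Complex.reCLM ∘ fun s =>
      ∑ a, ∑ b, su2Gen i a b * ∑ d, (∑ c, (γ s).1 b c * su2Gen j c d) * star ((γ s).1 a d)) y :=
    funext fun s => rotMatrix_apply (γ s) i j
  rw [e]
  refine h2.congr_deriv ?_
  simp [su2Coeff, Matrix.trace, Matrix.mul_apply, Matrix.conjTranspose_apply,
    Finset.sum_add_distrib]

/-- `dR = R ad(b) - ad(a) R` if `du = u b - a u`, where `R = Γ₁(u)`. With `a` and `b` the potentials
in two local sections and `u` the transition function, this is the transformation law of the spin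
connection. -/
theorem hasDerivAt_Gamma1_of_eq {γ : ℝ → SU2} {t : ℝ} {m : Matrix (Fin 2) (Fin 2) ℂ}
    (h : ∀ k l, HasDerivAt (fun s => (γ s).1 k l) (m k l) t) (a b : Fin 3 → ℝ)
    (hm : m = (γ t).1 * su2Alg b - su2Alg a * (γ t).1) (i j : Fin 3) :
    HasDerivAt (fun s => (Gamma1 (γ s)).1 i j)
      (((Gamma1 (γ t)).1 * adMatrix b - adMatrix a * (Gamma1 (γ t)).1) i j) t := by
  refine (hasDerivAt_Gamma1 h i j).congr_deriv ?_
  have e : m * su2Gen j * (γ t).1ᴴ + (γ t).1 * su2Gen j * mᴴ =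
      (γ t).1 * (su2Alg b * su2Gen j - su2Gen j * su2Alg b) * (γ t).1ᴴ -
      (su2Alg a * ((γ t).1 * su2Gen j * (γ t).1ᴴ) - ((γ t).1 * su2Gen j * (γ t).1ᴴ) * su2Alg a) := by
    rw [hm, Matrix.conjTranspose_sub, Matrix.conjTranspose_mul, Matrix.conjTranspose_mul,
      su2Alg_conjTranspose, su2Alg_conjTranspose]
    noncomm_ring
  rw [e, map_sub, su2Coeff_sum_conj, su2Alg_bracket, su2Coeff_conj_sum]
  simp [Matrix.mul_apply, Matrix.mulVec, dotProduct]

theorem hasDerivAt_Gamma1_at_one (γ : ℝ → SU2) (a : Fin 3 → ℝ) (h0 : γ 0 = 1)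
    (h : ∀ k l, HasDerivAt (fun t => (γ t).1 k l) (su2Alg a k l) 0) (i j : Fin 3) :
    HasDerivAt (fun t => (Gamma1 (γ t)).1 i j)
      ((∑ k, a k • ((1 / 2 : ℝ) • ∑ p, ∑ q, eps k p q • so3Gen p q)) i j) 0 := by
  have := hasDerivAt_Gamma1_of_eq h 0 a (by simp [h0, su2Alg]) i j
  rw [← adMatrix_eq_sum_so3Gen]
  have z : adMatrix 0 = 0 := by ext i j; simp [adMatrix]
  simpa [h0, z] using this

/-! ### Smooth partitions of unity on paracompact manifolds -/

section Partition

open Set Function Topology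

variable {M : Type*} [TopologicalSpace M] [T2Space M] [ChartedSpace E3 M]
  [IsManifold (𝓡 3) (⊤ : ℕ∞) M]

/-- Smooth Urysohn lemma for a compact set in an open set. Finitely many bump functions suffice, so
that `M` need not be `σ`-compact. -/
theorem exists_contMDiff_one_of_isCompact {K V : Set M} (hK : IsCompact K) (hV : IsOpen V)
    (hKV : K ⊆ V) : ∃ g : M → ℝ, ContMDiff (𝓡 3) 𝓘(ℝ, ℝ) (⊤ : ℕ∞) g ∧ EqOn g 1 K ∧
      support g ⊆ V ∧ ∀ x, g x ∈ Icc (0 : ℝ) 1 := by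
  have hb (x : K) : ∃ φ : SmoothBumpFunction (𝓡 3) x.1, tsupport φ ⊆ V := by
    obtain ⟨φ, -, hφ⟩ := (SmoothBumpFunction.nhds_basis_tsupport (I := 𝓡 3) x.1).mem_iff.1
      (hV.mem_nhds (hKV x.2))
    exact ⟨φ, hφ⟩
  choose φ hφ using hb
  obtain ⟨t, ht⟩ := hK.elim_finite_subcover (fun x : K => _root_.interior {y | φ x y = 1})
    (fun _ => isOpen_interior) fun x hx => mem_iUnion.2
      ⟨⟨x, hx⟩, mem_interior_iff_mem_nhds.2 (φ ⟨x, hx⟩).eventuallyEq_one⟩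
  -- The function is `1` where one of the bump functions is `1`, and `0` where all of them vanish.
  refine ⟨fun y => 1 - ∏ x ∈ t, (1 - φ x y), ?_, ?_, ?_, ?_⟩
  · exact contMDiff_const.sub
      (contMDiff_finsetProd fun x _ => contMDiff_const.sub (φ x).contMDiff)
  · intro y hy
    obtain ⟨x, hx, hxy⟩ := mem_iUnion₂.1 (ht hy)
    have h1 : y ∈ {y | φ x y = 1} := interior_subset hxy
    have h0 : ∏ x ∈ t, (1 - φ x y) = 0 := Finset.prod_eq_zero hx (sub_eq_zero.2 (Eq.symm h1))
    simp [h0]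
  · intro y hy
    by_contra hyV
    refine hy ?_
    have h0 (x : K) : φ x y = 0 := by
      by_contra h
      exact hyV (hφ x (subset_tsupport _ h))
    simp [h0]
  · intro y
    have h0 : 0 ≤ ∏ x ∈ t, (1 - φ x y) :=
      Finset.prod_nonneg fun x _ => sub_nonneg.2 (φ x).le_one
    have h1 : ∏ x ∈ t, (1 - φ x y) ≤ 1 :=
      Finset.prod_le_one (fun x _ => sub_nonneg.2 (φ x).le_one)
        fun x _ => sub_le_self _ (φ x).nonneg
    exact ⟨sub_nonneg.2 h1, sub_le_self _ h0⟩

/-- Smooth partitions of unity exist on paracompact manifolds, which need not be `σ`-compact (they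
may have uncountably many components). A locally finite refinement `V` by relatively compact sets is
shrunk to a cover `W`, and the smooth Urysohn lemma applies to the compact closures of `W`. -/
theorem exists_smoothPartitionOfUnity [ParacompactSpace M] (U : M → Set M) (hU : ∀ x, U x ∈ 𝓝 x) :
    ∃ ρ : SmoothPartitionOfUnity M (𝓡 3) M univ, ρ.IsSubordinate U := by
  have hb (x : M) : ∃ φ : SmoothBumpFunction (𝓡 3) x, tsupport φ ⊆ U x := by
    obtain ⟨φ, -, hφ⟩ := (SmoothBumpFunction.nhds_basis_tsupport (I := 𝓡 3) x).mem_iff.1 (hU x)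
    exact ⟨φ, hφ⟩
  choose φ hφ using hb
  -- The interiors of the sets `φ x = 1` are relatively compact, as `φ x` has compact support.
  obtain ⟨V, hVo, hVc, hVf, hVO⟩ := precise_refinement (fun x : M => _root_.interior {y | φ x y = 1})
    (fun _ => isOpen_interior) (iUnion_eq_univ_iff.2 fun x =>
      ⟨x, mem_interior_iff_mem_nhds.2 (φ x).eventuallyEq_one⟩)
  have hVt (x : M) : closure (V x) ⊆ tsupport (φ x) := closure_mono fun y hy => by
    have h1 : y ∈ {y | φ x y = 1} := interior_subset (hVO x hy)
    exact mem_support.2 (ne_of_eq_of_ne h1 one_ne_zero)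
  obtain ⟨W, hWc, hWo, hWV⟩ := exists_subset_iUnion_closure_subset isClosed_univ hVo
    (fun x _ => hVf.point_finite x) hVc.ge
  have hWK (x : M) : IsCompact (closure (W x)) :=
    (φ x).hasCompactSupport.isCompact.of_isClosed_subset isClosed_closure
      (((hWV x).trans subset_closure).trans (hVt x))
  choose g hg h1 hs h01 using fun x =>
    exists_contMDiff_one_of_isCompact (hWK x) (hVo x) (hWV x)
  let b : BumpCovering M M univ :=
    { toFun := fun x => ⟨g x, (hg x).continuous⟩
      locallyFinite' := hVf.subset hs
      nonneg' := fun x y => (h01 x y).1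
      le_one' := fun x y => (h01 x y).2
      eventuallyEq_one' := fun y _ => by
        obtain ⟨x, hx⟩ := mem_iUnion.1 (hWc (mem_univ y))
        exact ⟨x, ((h1 x).mono subset_closure).eventuallyEq_of_mem ((hWo x).mem_nhds hx)⟩ }
  have hbU : b.IsSubordinate U := fun x => ((closure_mono (hs x)).trans (hVt x)).trans (hφ x)
  exact ⟨b.toSmoothPartitionOfUnity hg, hbU.toSmoothPartitionOfUnity hg⟩

end Partition

/-! ### Transition functions -/

namespace PrincipalBundle

variable {G : Type*} [Group G] [TopologicalSpace G]
  {W : Type*} [NormedAddCommGroup W] [NormedSpace ℝ W] {coords : G → W} {ι : Type*}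
  {M : Type*} [TopologicalSpace M] [ChartedSpace E3 M]
  {P : Type*} [TopologicalSpace P] [MulAction Gᵐᵒᵖ P]

variable (B : PrincipalBundle G coords ι M P)

theorem isOpen_domain (a : ι) : IsOpen (B.domain a) := (B.triv a).open_baseSet

theorem mem_source_iff (a : ι) (p : P) : p ∈ (B.triv a).source ↔ B.proj p ∈ B.domain a :=
  (B.triv a).mem_source

theorem triv_fst {a : ι} {p : P} (hp : B.proj p ∈ B.domain a) : (B.triv a p).1 = B.proj p :=
  (B.triv a).coe_fst ((B.mem_source_iff a p).2 hp)

/-- The point with coordinates `(x, g)` in the trivialization over `U_a`. -/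
def point (a : ι) (x : M) (g : G) : P := (B.triv a).toOpenPartialHomeomorph.symm (x, g)

theorem proj_point {a : ι} {x : M} (hx : x ∈ B.domain a) (g : G) :
    B.proj (B.point a x g) = x :=
  (B.triv a).proj_symm_apply' hx

theorem triv_point {a : ι} {x : M} (hx : x ∈ B.domain a) (g : G) :
    B.triv a (B.point a x g) = (x, g) :=
  (B.triv a).apply_symm_apply' hx

theorem proj_localSection {a : ι} {x : M} (hx : x ∈ B.domain a) :
    B.proj (B.localSection a x) = x := B.proj_point hx 1

theorem triv_localSection {a : ι} {x : M} (hx : x ∈ B.domain a) :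
    B.triv a (B.localSection a x) = (x, 1) := B.triv_point hx 1

/-- A point is determined by its base point and its group coordinate. -/
theorem ext_triv {a : ι} {p q : P} (hp : B.proj p ∈ B.domain a) (hq : B.proj q = B.proj p)
    (h : (B.triv a p).2 = (B.triv a q).2) : p = q := by
  have hq' : B.proj q ∈ B.domain a := hq ▸ hp
  refine (B.triv a).injOn ((B.mem_source_iff a p).2 hp) ((B.mem_source_iff a q).2 hq') ?_
  exact Prod.ext ((B.triv_fst hp).trans (hq.symm.trans (B.triv_fst hq').symm)) h

theorem proj_smul (p : P) (g : G) : B.proj (MulOpposite.op g • p) = B.proj p := by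
  obtain ⟨a, ha⟩ := B.cover (B.proj p)
  obtain ⟨h1, h2⟩ := B.equivariant a p g ((B.mem_source_iff a p).2 ha)
  rw [← B.triv_fst ((B.mem_source_iff a _).1 h1), h2, B.triv_fst ha]

theorem triv_smul {a : ι} {p : P} (hp : B.proj p ∈ B.domain a) (g : G) :
    (B.triv a (MulOpposite.op g • p)).2 = (B.triv a p).2 * g := by
  rw [(B.equivariant a p g ((B.mem_source_iff a p).2 hp)).2]

/-- Every point is obtained from the local section by its group coordinate. -/
theorem eq_smul_localSection {a : ι} {p : P} (hp : B.proj p ∈ B.domain a) :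
    p = MulOpposite.op (B.triv a p).2 • B.localSection a (B.proj p) := by
  have h := B.proj_localSection hp
  refine B.ext_triv hp (by rw [B.proj_smul, h]) ?_
  rw [B.triv_smul (by rwa [h]), B.triv_localSection hp, one_mul]

/-- The change of group coordinates. -/
theorem triv_eq_transition_mul {a b : ι} {p : P} (ha : B.proj p ∈ B.domain a)
    (hb : B.proj p ∈ B.domain b) :
    (B.triv a p).2 = B.transition a b (B.proj p) * (B.triv b p).2 := by
  conv_lhs => rw [B.eq_smul_localSection hb]
  rw [B.triv_smul (by rwa [B.proj_localSection hb])]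
  rfl

theorem transition_mul_transition {a b c : ι} {x : M} (ha : x ∈ B.domain a) (hb : x ∈ B.domain b)
    (hc : x ∈ B.domain c) :
    B.transition a c x = B.transition a b x * B.transition b c x := by
  have h := B.proj_localSection hc
  have := B.triv_eq_transition_mul (p := B.localSection c x) (a := a) (b := b)
    (by rwa [h]) (by rwa [h])
  rwa [h] at this

theorem contMDiffOn_transition (a b : ι) : ContMDiffOn (𝓡 3) 𝓘(ℝ, W) (⊤ : ℕ∞)
    (fun x => coords (B.transition a b x)) (B.domain a ∩ B.domain b) :=
  B.smooth_transition a b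

end PrincipalBundle

section PoincareBundle

variable {M : Type*} [TopologicalSpace M] [ChartedSpace E3 M]
  {P : Type*} [TopologicalSpace P] [MulAction Poincareᵐᵒᵖ P] {ι : Type*}
  (B : PrincipalBundle Poincare Poincare.coords ι M P)

theorem contMDiffOn_transition_rot (a b : ι) (k l : Fin 2) :
    ContMDiffOn (𝓡 3) 𝓘(ℝ, ℂ) (⊤ : ℕ∞) (fun x => (B.transition a b x).rot.1 k l)
      (B.domain a ∩ B.domain b) := by
  have h := (ContinuousLinearMap.fst ℝ (Fin 2 → Fin 2 → ℂ) (Fin 3 → ℝ)).contMDiff.comp_contMDiffOn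
    (B.contMDiffOn_transition a b)
  exact (contMDiffOn_pi_space.1 (contMDiffOn_pi_space.1 h k) l)

theorem contMDiffOn_transition_trans (a b : ι) :
    ContMDiffOn (𝓡 3) 𝓘(ℝ, Fin 3 → ℝ) (⊤ : ℕ∞) (fun x => (B.transition a b x).trans)
      (B.domain a ∩ B.domain b) :=
  (ContinuousLinearMap.snd ℝ (Fin 2 → Fin 2 → ℂ) (Fin 3 → ℝ)).contMDiff.comp_contMDiffOn
    (B.contMDiffOn_transition a b)

theorem contMDiffOn_transition_Gamma1 (a b : ι) (i j : Fin 3) :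
    ContMDiffOn (𝓡 3) 𝓘(ℝ, ℝ) (⊤ : ℕ∞) (fun x => (Gamma1 (B.transition a b x).rot).1 i j)
      (B.domain a ∩ B.domain b) := by
  -- `Γ₁` is the restriction of a polynomial in the entries and their conjugates.
  have hs : ContDiff ℝ (⊤ : ℕ∞) fun m : Fin 2 → Fin 2 → ℂ => -2 * (∑ a, ∑ b, su2Gen i a b *
      ∑ d, (∑ c, m b c * su2Gen j c d) * star (m a d)).re := by
    refine contDiff_const.mul (Complex.reCLM.contDiff.comp (f := fun m : Fin 2 → Fin 2 → ℂ =>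
      ∑ a, ∑ b, su2Gen i a b * ∑ d, (∑ c, m b c * su2Gen j c d) * star (m a d)) ?_)
    refine ContDiff.sum fun a _ => ContDiff.sum fun b _ => contDiff_const.mul
      (ContDiff.sum fun d _ => ContDiff.mul (ContDiff.sum fun c _ => ?_) ?_)
    · exact (contDiff_apply_apply ℝ ℂ b c).mul contDiff_const
    · exact (Complex.conjCLE.contDiff).comp (contDiff_apply_apply ℝ ℂ a d)
  have h := hs.contMDiff.comp_contMDiffOn
    ((ContinuousLinearMap.fst ℝ (Fin 2 → Fin 2 → ℂ) (Fin 3 → ℝ)).contMDiff.comp_contMDiffOn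
      (B.contMDiffOn_transition a b))
  exact h.congr fun x _ => rotMatrix_apply _ i j

/-- The cocycle relation for the translation parts of the transition functions. -/
theorem transition_trans_eq {a b c : ι} {x : M} (ha : x ∈ B.domain a) (hb : x ∈ B.domain b)
    (hc : x ∈ B.domain c) :
    (B.transition a c x).trans = (B.transition a b x).trans +
      (Gamma1 (B.transition a b x).rot).1 *ᵥ (B.transition b c x).trans := by
  rw [B.transition_mul_transition ha hb hc, Poincare.mul_def]

variable [T2Space M] [ParacompactSpace M] [IsManifold (𝓡 3) (⊤ : ℕ∞) M]

/-- The fibre of `P / SU(2)` is the affine space `ℝ³`, so that a global section is obtained by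
averaging local ones with a partition of unity. -/
theorem nonempty_stabilitySubbundle : Nonempty (StabilitySubbundle B) := by
  choose β hβ using B.cover
  obtain ⟨ρ, hρ⟩ := exists_smoothPartitionOfUnity (fun x => B.domain (β x))
    fun x => (B.isOpen_domain _).mem_nhds (hβ x)
  let s : ι → M → Fin 3 → ℝ := fun a x => ∑ᶠ y, ρ y x • (B.transition a (β y) x).trans
  have hmem {y x : M} (h : ρ y x ≠ 0) : x ∈ B.domain (β y) := hρ y (subset_tsupport _ h)
  have hsum (a : ι) (x : M) : s a x = ∑ y ∈ ρ.finsupport x, ρ y x • (B.transition a (β y) x).trans :=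
    (ρ.sum_finsupport_smul_eq_finsum x fun y x => (B.transition a (β y) x).trans).symm
  have hs {a b : ι} {x : M} (ha : x ∈ B.domain a) (hb : x ∈ B.domain b) :
      s a x = (B.transition a b x).trans + (Gamma1 (B.transition a b x).rot).1 *ᵥ s b x := by
    rw [hsum, hsum, Matrix.mulVec_sum]
    have h1 : (B.transition a b x).trans =
        ∑ y ∈ ρ.finsupport x, ρ y x • (B.transition a b x).trans := by
      rw [← Finset.sum_smul, ρ.sum_finsupport x (Set.mem_univ x), one_smul]
    conv_rhs => rw [h1]
    rw [← Finset.sum_add_distrib]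
    refine Finset.sum_congr rfl fun y hy => ?_
    have hy' : x ∈ B.domain (β y) := hmem ((ρ.mem_finsupport x).1 hy)
    rw [transition_trans_eq B ha hb hy', smul_add, Matrix.mulVec_smul]
  have key {a b : ι} {p : P} (ha : B.proj p ∈ B.domain a) (hb : B.proj p ∈ B.domain b)
      (h : (B.triv b p).2.trans = s b (B.proj p)) : (B.triv a p).2.trans = s a (B.proj p) := by
    rw [B.triv_eq_transition_mul ha hb, Poincare.mul_def, hs ha hb, h]
  refine ⟨⟨{p | ∃ a, B.proj p ∈ B.domain a ∧ (B.triv a p).2.trans = s a (B.proj p)}, s, ?_, ?_⟩⟩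
  · intro a x hx
    refine (ρ.contMDiffAt_finsum fun y hy => ?_).contMDiffWithinAt
    exact (contMDiffOn_transition_trans B a (β y)).contMDiffAt
      (((B.isOpen_domain a).inter (B.isOpen_domain _)).mem_nhds ⟨hx, hρ y hy⟩)
  · intro a p hp
    have ha := (B.mem_source_iff a p).1 hp
    exact ⟨fun ⟨b, hb, h⟩ => key ha hb h, fun h => ⟨a, ha, h⟩⟩

end PoincareBundle

namespace StabilitySubbundle

variable {M : Type*} [TopologicalSpace M] [ChartedSpace E3 M]
  {P : Type*} [TopologicalSpace P] [MulAction Poincareᵐᵒᵖ P] {ι : Type*}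
  {B : PrincipalBundle Poincare Poincare.coords ι M P}

/-- The sections `s_a` of the affine bundle `P / SU(2)` transform with the action of the group on
`ℝ³`. -/
theorem s_eq (Q : StabilitySubbundle B) {a b : ι} {x : M} (ha : x ∈ B.domain a)
    (hb : x ∈ B.domain b) :
    Q.s a x = (B.transition a b x).trans + (Gamma1 (B.transition a b x).rot).1 *ᵥ Q.s b x := by
  have hp := B.proj_point hb (⟨1, Q.s b x⟩ : Poincare)
  set p := B.point b x (⟨1, Q.s b x⟩ : Poincare) with hpdef
  have h1 : p ∈ Q.carrier := (Q.mem_iff b p ((B.mem_source_iff b p).2 (by rwa [hp]))).2 (by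
    rw [hp, hpdef, B.triv_point hb])
  have h2 := (Q.mem_iff a p ((B.mem_source_iff a p).2 (by rwa [hp]))).1 h1
  rw [B.triv_eq_transition_mul (b := b) (by rwa [hp]) (by rwa [hp]), hp, hpdef, B.triv_point hb,
    Poincare.mul_def] at h2
  exact h2.symm

theorem contMDiffOn_s (Q : StabilitySubbundle B) (a : ι) (j : Fin 3) :
    ContMDiffOn (𝓡 3) 𝓘(ℝ, ℝ) (⊤ : ℕ∞) (fun y => Q.s a y j) (B.domain a) :=
  contMDiffOn_pi_space.1 (Q.smooth a) j

end StabilitySubbundle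

/-! ### Calculus of 1-forms in charts -/

section Calculus

open Bundle Topology

variable {M : Type*} [TopologicalSpace M] [ChartedSpace E3 M]

theorem eventually_mem_chart_source (x₀ : M) : ∀ᶠ y in 𝓝 x₀, y ∈ (chartAt E3 x₀).source :=
  (chartAt E3 x₀).open_source.mem_nhds (mem_chart_source E3 x₀)

theorem eventually_mem_target (x₀ : M) :
    ∀ᶠ z in 𝓝 (extChartAt (𝓡 3) x₀ x₀), z ∈ (extChartAt (𝓡 3) x₀).target :=
  extChartAt_target_mem_nhds x₀

theorem mfderiv_eq_fderiv_chart {F : Type*} [NormedAddCommGroup F] [NormedSpace ℝ F]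
    {f : M → F} {x₀ : M} (hf : MDifferentiableAt (𝓡 3) 𝓘(ℝ, F) f x₀) (v : TangentSpace (𝓡 3) x₀) :
    mfderiv (𝓡 3) 𝓘(ℝ, F) f x₀ v =
      fderiv ℝ (f ∘ (extChartAt (𝓡 3) x₀).symm) (extChartAt (𝓡 3) x₀ x₀) v := by
  rw [hf.mfderiv, ModelWithCorners.Boundaryless.range_eq_univ, fderivWithin_univ]
  rfl

/-- The curve through `x₀` with velocity `v` which is a straight line in the preferred chart. -/
noncomputable def chartCurve (x₀ : M) (v : E3) (t : ℝ) : M :=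
  (extChartAt (𝓡 3) x₀).symm (extChartAt (𝓡 3) x₀ x₀ + t • v)

theorem chartCurve_zero (x₀ : M) (v : E3) : chartCurve x₀ v 0 = x₀ := by
  simp [chartCurve]

theorem continuousAt_chartCurve (x₀ : M) (v : E3) :
    ContinuousAt (chartCurve x₀ v) 0 := by
  refine ContinuousAt.comp (g := (extChartAt (𝓡 3) x₀).symm) ?_ (by fun_prop)
  simpa using continuousAt_extChartAt_symm (I := 𝓡 3) x₀

theorem eventually_chartCurve_mem {U : Set M} (hU : IsOpen U) {x₀ : M} (hx : x₀ ∈ U)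
    (v : E3) : ∀ᶠ t in 𝓝 (0 : ℝ), chartCurve x₀ v t ∈ U :=
  (continuousAt_chartCurve x₀ v).eventually_mem
    (by rw [chartCurve_zero]; exact hU.mem_nhds hx)

/-- Differentials are derivatives along curves, which reduces identities between differentials on
the manifold to the calculus of one variable. -/
theorem hasDerivAt_chartCurve {F : Type*} [NormedAddCommGroup F] [NormedSpace ℝ F]
    {f : M → F} {x₀ : M} (hf : MDifferentiableAt (𝓡 3) 𝓘(ℝ, F) f x₀) (v : E3) :
    HasDerivAt (fun t => f (chartCurve x₀ v t)) (mfderiv (𝓡 3) 𝓘(ℝ, F) f x₀ v) 0 := by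
  have h : HasFDerivAt (writtenInExtChartAt (𝓡 3) 𝓘(ℝ, F) x₀ f)
      (mfderiv (𝓡 3) 𝓘(ℝ, F) f x₀ : E3 →L[ℝ] F) (extChartAt (𝓡 3) x₀ x₀) := by
    have h0 := hf.hasMFDerivAt.2
    rw [ModelWithCorners.Boundaryless.range_eq_univ] at h0
    exact hasFDerivWithinAt_univ.1 h0
  have hl : HasDerivAt (fun t : ℝ => extChartAt (𝓡 3) x₀ x₀ + t • v)
      v 0 := by
    have h1 := ((hasDerivAt_id (0 : ℝ)).smul_const v).const_add (extChartAt (𝓡 3) x₀ x₀)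
    rwa [one_smul] at h1
  have h' : HasFDerivAt (writtenInExtChartAt (𝓡 3) 𝓘(ℝ, F) x₀ f) (mfderiv (𝓡 3) 𝓘(ℝ, F) f x₀)
      (extChartAt (𝓡 3) x₀ x₀ + (0 : ℝ) • v) := by
    rw [zero_smul, add_zero]; exact h
  exact h'.comp_hasDerivAt (0 : ℝ) hl

variable [IsManifold (𝓡 3) (⊤ : ℕ∞) M]

/-- The trivialization of the tangent bundle near `x₀`, as a map from the model space: the
coordinate frame at `y` of the preferred chart at `x₀`. -/
noncomputable def coordFrame (x₀ y : M) : E3 →L[ℝ] TangentSpace (𝓡 3) y :=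
  (trivializationAt E3 (TangentSpace (𝓡 3)) x₀).symmL ℝ y

/-- The inverse of `coordFrame`. -/
noncomputable def coordCoframe (x₀ y : M) : TangentSpace (𝓡 3) y →L[ℝ] E3 :=
  (trivializationAt E3 (TangentSpace (𝓡 3)) x₀).continuousLinearMapAt ℝ y

theorem mem_baseSet_of_mem_source {x₀ y : M} (hy : y ∈ (chartAt E3 x₀).source) :
    y ∈ (trivializationAt E3 (TangentSpace (𝓡 3) : M → Type _) x₀).baseSet := by
  rwa [TangentBundle.trivializationAt_baseSet]

theorem coordFrame_coordCoframe {x₀ y : M} (hy : y ∈ (chartAt E3 x₀).source)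
    (v : TangentSpace (𝓡 3) y) : coordFrame x₀ y (coordCoframe x₀ y v) = v :=
  Trivialization.symmL_continuousLinearMapAt _ (mem_baseSet_of_mem_source hy) v

theorem coordFrame_self (x : M) (v : E3) : coordFrame x x v = v := by
  rw [coordFrame, TangentBundle.symmL_trivializationAt_eq_core (mem_chart_source E3 x)]
  exact tangentCoordChange_self (I := 𝓡 3) (mem_extChartAt_source x)

/-- The preferred trivialization of the tangent bundle is the differential of the chart. -/
theorem mfderiv_extChartAt_symm {x₀ : M} {z : E3} (hz : z ∈ (extChartAt (𝓡 3) x₀).target) :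
    mfderiv 𝓘(ℝ, E3) (𝓡 3) (extChartAt (𝓡 3) x₀).symm z =
      coordFrame x₀ ((extChartAt (𝓡 3) x₀).symm z) := by
  have hs : (extChartAt (𝓡 3) x₀).symm z ∈ (chartAt E3 x₀).source := by
    rw [← extChartAt_source (𝓡 3)]
    exact (extChartAt (𝓡 3) x₀).map_target hz
  rw [coordFrame, TangentBundle.symmL_trivializationAt hs, (extChartAt (𝓡 3) x₀).right_inv hz,
    ModelWithCorners.Boundaryless.range_eq_univ, mfderivWithin_univ]

theorem contMDiffAt_extChartAt_symm (x₀ : M) :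
    ContMDiffAt 𝓘(ℝ, E3) (𝓡 3) (⊤ : ℕ∞) (extChartAt (𝓡 3) x₀).symm (extChartAt (𝓡 3) x₀ x₀) :=
  (contMDiffOn_extChartAt_symm x₀).contMDiffAt (eventually_mem_target x₀)

/-- A function which is smooth near `x₀` is smooth in the preferred chart. -/
theorem contDiffAt_comp_extChartAt_symm {F : Type*} [NormedAddCommGroup F] [NormedSpace ℝ F]
    {f : M → F} {x₀ : M} (hf : ContMDiffAt (𝓡 3) 𝓘(ℝ, F) (⊤ : ℕ∞) f x₀) :
    ContDiffAt ℝ (⊤ : ℕ∞) (f ∘ (extChartAt (𝓡 3) x₀).symm) (extChartAt (𝓡 3) x₀ x₀) := by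
  have h : ContMDiffAt (𝓡 3) 𝓘(ℝ, F) (⊤ : ℕ∞) f
      ((extChartAt (𝓡 3) x₀).symm (extChartAt (𝓡 3) x₀ x₀)) := by
    rwa [extChartAt_to_inv]
  exact (h.comp _ (contMDiffAt_extChartAt_symm x₀)).contDiffAt

/-- The components of a 1-form in the coordinates of the preferred chart at `x₀`. -/
noncomputable def formCoord (β : OneForm M) (x₀ y : M) : E3 →L[ℝ] ℝ :=
  (β y).comp (coordFrame x₀ y)

/-- A 1-form is smooth at a point if and only if its components in the chart there are. -/
theorem contMDiffAt_oneForm_iff {β : OneForm M} {x₀ : M} :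
    ContMDiffAt (𝓡 3) ((𝓡 3).prod 𝓘(ℝ, E3 →L[ℝ] ℝ)) (⊤ : ℕ∞)
      (fun x => (TotalSpace.mk' (E3 →L[ℝ] ℝ) x (β x) :
        TotalSpace (E3 →L[ℝ] ℝ) (fun x : M => TangentSpace (𝓡 3) x →L[ℝ] ℝ))) x₀ ↔
      ContMDiffAt (𝓡 3) 𝓘(ℝ, E3 →L[ℝ] ℝ) (⊤ : ℕ∞) (formCoord β x₀) x₀ := by
  rw [contMDiffAt_hom_bundle]
  have h : (fun x => ContinuousLinearMap.inCoordinates E3 (TangentSpace (𝓡 3)) ℝ (Trivial M ℝ)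
      x₀ x x₀ x (β x)) = formCoord β x₀ := by
    funext x
    ext v
    simp [ContinuousLinearMap.inCoordinates, formCoord, coordFrame]
  constructor
  · intro hh
    rw [← h]; exact hh.2
  · intro hh
    rw [← h] at hh
    exact ⟨contMDiffAt_id, hh⟩

theorem OneForm.smoothOn_iff {β : OneForm M} {U : Set M} (hU : IsOpen U) :
    β.SmoothOn U ↔
      ∀ x ∈ U, ContMDiffAt (𝓡 3) 𝓘(ℝ, E3 →L[ℝ] ℝ) (⊤ : ℕ∞) (formCoord β x) x := by
  refine forall₂_congr fun x hx => ?_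
  rw [← contMDiffAt_oneForm_iff]
  exact ⟨fun h => h.contMDiffAt (hU.mem_nhds hx), fun h => h.contMDiffWithinAt⟩

theorem OneForm.SmoothOn.add {β γ : OneForm M} {U : Set M} (hU : IsOpen U) (hβ : β.SmoothOn U)
    (hγ : γ.SmoothOn U) : OneForm.SmoothOn (fun x => β x + γ x) U := by
  rw [OneForm.smoothOn_iff hU] at *
  exact fun x hx => (hβ x hx).add (hγ x hx)

theorem OneForm.SmoothOn.smul {f : M → ℝ} {β : OneForm M} {U : Set M} (hU : IsOpen U)
    (hf : ContMDiffOn (𝓡 3) 𝓘(ℝ, ℝ) (⊤ : ℕ∞) f U) (hβ : β.SmoothOn U) :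
    OneForm.SmoothOn (fun x => f x • β x) U := by
  rw [OneForm.smoothOn_iff hU] at *
  exact fun x hx => (hf.contMDiffAt (hU.mem_nhds hx)).smul (hβ x hx)

theorem OneForm.SmoothOn.sum {κ : Type*} {β : κ → OneForm M} {t : Finset κ} {U : Set M}
    (hU : IsOpen U) (hβ : ∀ k, (β k).SmoothOn U) :
    OneForm.SmoothOn (fun x => ∑ k ∈ t, β k x) U := by
  simp only [OneForm.smoothOn_iff hU] at *
  intro x hx
  have h : ContMDiffAt (𝓡 3) 𝓘(ℝ, E3 →L[ℝ] ℝ) (⊤ : ℕ∞)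
    (fun y => ∑ k ∈ t, formCoord (β k) x y) x := contMDiffAt_finsetSum fun k _ => hβ k x hx
  refine h.congr_of_eventuallyEq (Filter.Eventually.of_forall fun y => ?_)
  ext v
  simp [formCoord]

theorem smoothOn_dFun {f : M → ℝ} {U : Set M} (hU : IsOpen U)
    (hf : ContMDiffOn (𝓡 3) 𝓘(ℝ, ℝ) (⊤ : ℕ∞) f U) : (dFun f).SmoothOn U := by
  rw [OneForm.smoothOn_iff hU]
  intro x hx
  have h := (hf.contMDiffAt (hU.mem_nhds hx)).mfderiv_const (m := (⊤ : ℕ∞)) (by norm_num)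
  refine h.congr_of_eventuallyEq (Filter.Eventually.of_forall fun y => ?_)
  ext v
  simp only [inTangentCoordinates, ContinuousLinearMap.inCoordinates,
    TangentBundle.continuousLinearMapAt_model_space]
  rfl

/-- The expression of a 1-form in a chart is given by its components in the coordinate frame. -/
theorem inChart_eq (β : OneForm M) {x₀ : M} {z : E3} (hz : z ∈ (extChartAt (𝓡 3) x₀).target) :
    inChart β x₀ z = formCoord β x₀ ((extChartAt (𝓡 3) x₀).symm z) := by
  rw [inChart, mfderiv_extChartAt_symm hz]; rfl

theorem OneForm.SmoothOn.differentiableAt_inChart {β : OneForm M} {U : Set M} (hU : IsOpen U)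
    (hβ : β.SmoothOn U) {x : M} (hx : x ∈ U) :
    DifferentiableAt ℝ (inChart β x) (extChartAt (𝓡 3) x x) := by
  have h := contDiffAt_comp_extChartAt_symm ((OneForm.smoothOn_iff hU).1 hβ x hx)
  refine (h.differentiableAt (by simp)).congr_of_eventuallyEq ?_
  filter_upwards [eventually_mem_target x] with z hz using inChart_eq β hz

theorem fieldInChart_eq (X : ∀ x : M, TangentSpace (𝓡 3) x) {x₀ : M} {z : E3}
    (hz : z ∈ (extChartAt (𝓡 3) x₀).target) :
    fieldInChart X x₀ z = coordCoframe x₀ ((extChartAt (𝓡 3) x₀).symm z)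
      (X ((extChartAt (𝓡 3) x₀).symm z)) := by
  have hs : (extChartAt (𝓡 3) x₀).symm z ∈ (chartAt E3 x₀).source := by
    rw [← extChartAt_source (𝓡 3)]
    exact (extChartAt (𝓡 3) x₀).map_target hz
  set e := (trivializationAt E3 (TangentSpace (𝓡 3)) x₀).continuousLinearEquivAt ℝ _
    (mem_baseSet_of_mem_source hs) with he
  have h : mfderiv 𝓘(ℝ, E3) (𝓡 3) (extChartAt (𝓡 3) x₀).symm z = (e.symm : E3 →L[ℝ] _) :=
    (mfderiv_extChartAt_symm hz).trans (ContinuousLinearMap.ext fun v =>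
      (congrFun (Trivialization.symm_continuousLinearEquivAt_eq _ _) v).symm)
  have hinv : ∀ A : E3 →L[ℝ] TangentSpace (𝓡 3) ((extChartAt (𝓡 3) x₀).symm z),
      A = (e.symm : E3 →L[ℝ] _) → ∀ v, A.inverse v = coordCoframe x₀ _ v := by
    rintro _ rfl v
    rw [ContinuousLinearMap.inverse_equiv]
    exact congrFun (Trivialization.coe_continuousLinearEquivAt_eq _ (mem_baseSet_of_mem_source hs)) v
  exact hinv _ h _

/-- A vector field is smooth at a point if and only if its components in the chart there are. -/
theorem contMDiffAt_vectorField_iff {X : ∀ x : M, TangentSpace (𝓡 3) x} {x₀ : M} :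
    ContMDiffAt (𝓡 3) ((𝓡 3).prod 𝓘(ℝ, E3)) (⊤ : ℕ∞)
      (fun x => (TotalSpace.mk' E3 x (X x) : TangentBundle (𝓡 3) M)) x₀ ↔
    ContMDiffAt (𝓡 3) 𝓘(ℝ, E3) (⊤ : ℕ∞) (fun y => coordCoframe x₀ y (X y)) x₀ := by
  rw [contMDiffAt_section]
  refine Filter.EventuallyEq.contMDiffAt_iff ?_
  filter_upwards [eventually_mem_chart_source x₀] with y hy
  exact (Trivialization.continuousLinearMapAt_apply_of_mem ℝ _ (mem_baseSet_of_mem_source hy) _).symm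

theorem differentiableAt_fieldInChart (X : VectorField M) (x : M) :
    DifferentiableAt ℝ (fieldInChart X x) (extChartAt (𝓡 3) x x) := by
  have h := contDiffAt_comp_extChartAt_symm (contMDiffAt_vectorField_iff.1 (X.contMDiff x))
  refine (h.differentiableAt (by simp)).congr_of_eventuallyEq ?_
  filter_upwards [eventually_mem_target x] with z hz using fieldInChart_eq X hz

theorem fieldInChart_self (X : ∀ x : M, TangentSpace (𝓡 3) x) (x : M) :
    fieldInChart X x (extChartAt (𝓡 3) x x) = X x := by
  rw [fieldInChart_eq X (mem_extChartAt_target x), extChartAt_to_inv]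
  have h := coordFrame_coordCoframe (mem_chart_source E3 x) (X x)
  rwa [coordFrame_self] at h

theorem interior_comp_extChartAt_symm (X : ∀ x : M, TangentSpace (𝓡 3) x) (β : OneForm M) (x : M) :
    interior X β ∘ (extChartAt (𝓡 3) x).symm =ᶠ[𝓝 (extChartAt (𝓡 3) x x)]
      fun z => inChart β x z (fieldInChart X x z) := by
  filter_upwards [eventually_mem_target x] with z hz
  have hs : (extChartAt (𝓡 3) x).symm z ∈ (chartAt E3 x).source := by
    rw [← extChartAt_source (𝓡 3)]
    exact (extChartAt (𝓡 3) x).map_target hz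
  rw [inChart_eq β hz, fieldInChart_eq X hz]
  exact (congrArg (β _) (coordFrame_coordCoframe hs _)).symm

theorem contMDiffOn_interior (X : VectorField M) {β : OneForm M} {U : Set M} (hU : IsOpen U)
    (hβ : β.SmoothOn U) : ContMDiffOn (𝓡 3) 𝓘(ℝ, ℝ) (⊤ : ℕ∞) (interior X β) U := by
  intro x hx
  have h1 := (OneForm.smoothOn_iff hU).1 hβ x hx
  have h2 := contMDiffAt_vectorField_iff.1 (X.contMDiff x)
  refine ((h1.clm_apply h2).congr_of_eventuallyEq ?_).contMDiffWithinAt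
  filter_upwards [eventually_mem_chart_source x] with y hy
  exact (congrArg (β _) (coordFrame_coordCoframe hy _)).symm

/-- Cartan's formula `L_X β = i_X dβ + d(i_X β)`. -/
theorem lieD_eq (X : VectorField M) {β : OneForm M} {U : Set M} (hU : IsOpen U)
    (hβ : β.SmoothOn U) {x : M} (hx : x ∈ U) (v : TangentSpace (𝓡 3) x) :
    lieD X β x v = extD β x (X x) v + dFun (interior X β) x v := by
  have hd := ((contMDiffOn_interior X hU hβ).contMDiffAt (hU.mem_nhds hx)).mdifferentiableAt
    (by simp)
  have h1 := hβ.differentiableAt_inChart hU hx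
  have h2 := differentiableAt_fieldInChart X x
  have h3 : dFun (interior X β) x v =
      inChart β x (extChartAt (𝓡 3) x x) (fderiv ℝ (fieldInChart X x) (extChartAt (𝓡 3) x x) v) +
      fderiv ℝ (inChart β x) (extChartAt (𝓡 3) x x) v (X x) := by
    refine (mfderiv_eq_fderiv_chart hd v).trans ?_
    rw [(interior_comp_extChartAt_symm X β x).fderiv_eq]
    have h4 := (h1.hasFDerivAt.clm_apply h2.hasFDerivAt).fderiv
    rw [h4, fieldInChart_self]
    rfl
  rw [h3]
  change (fderiv ℝ (inChart β x) (extChartAt (𝓡 3) x x) (X x)) v + _ = _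
  simp only [extD]
  change _ + (inChart β x (extChartAt (𝓡 3) x x)) (fderiv ℝ (fieldInChart X x)
    (extChartAt (𝓡 3) x x) v) = _
  ring

theorem extD_sum_smul {κ : Type*} {t : Finset κ} {β : κ → OneForm M} {c : κ → ℝ} {U : Set M}
    (hU : IsOpen U) (hβ : ∀ k, (β k).SmoothOn U) {x : M} (hx : x ∈ U)
    (u v : TangentSpace (𝓡 3) x) :
    extD (fun y => ∑ k ∈ t, c k • β k y) x u v = ∑ k ∈ t, c k * extD (β k) x u v := by
  have h : inChart (fun y => ∑ k ∈ t, c k • β k y) x = fun z => ∑ k ∈ t, c k • inChart (β k) x z := by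
    have e (y : M) (w : TangentSpace (𝓡 3) y) :
        (∑ k ∈ t, c k • β k y) w = ∑ k ∈ t, c k * β k y w := by simp
    funext z
    refine ContinuousLinearMap.ext fun w => (e _ _).trans ?_
    simp only [sum_apply, smul_apply, smul_eq_mul]
    rfl
  have hd := fun k => (hβ k).differentiableAt_inChart hU hx
  have h' : fderiv ℝ (fun z => ∑ k ∈ t, c k • inChart (β k) x z) (extChartAt (𝓡 3) x x) =
      ∑ k ∈ t, c k • fderiv ℝ (inChart (β k) x) (extChartAt (𝓡 3) x x) := by
    rw [fderiv_fun_sum (A := fun k z => c k • inChart (β k) x z) fun k _ => (hd k).const_smul (c k)]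
    exact Finset.sum_congr rfl fun k _ => fderiv_const_smul (hd k) (c k)
  simp only [extD, h, h', mul_sub, Finset.sum_sub_distrib]
  have e (p q : E3) : (∑ k ∈ t, c k • fderiv ℝ (inChart (β k) x) (extChartAt (𝓡 3) x x)) p q =
      ∑ k ∈ t, c k * fderiv ℝ (inChart (β k) x) (extChartAt (𝓡 3) x x) p q := by
    simp
  exact congrArg₂ (· - ·) (e u v) (e v u)

theorem extD_smul_form {β : OneForm M} {c : ℝ} {U : Set M}
    (hU : IsOpen U) (hβ : β.SmoothOn U) {x : M} (hx : x ∈ U) (u v : TangentSpace (𝓡 3) x) :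
    extD (fun y => c • β y) x u v = c * extD β x u v := by
  have h := extD_sum_smul (t := Finset.univ) (β := fun _ : Unit => β) (c := fun _ => c) hU
    (fun _ => hβ) hx u v
  simpa using h

/-- Every tangent vector is the value of a smooth vector field: a constant field in a chart, cut off
by a bump function. -/
theorem exists_vectorField_eq [T2Space M] (x : M) (v : TangentSpace (𝓡 3) x) :
    ∃ X : VectorField M, X x = v := by
  obtain ⟨φ, -, hφ⟩ := (SmoothBumpFunction.nhds_basis_tsupport (I := 𝓡 3) x).mem_iff.1
    (eventually_mem_chart_source x)
  obtain ⟨w, hw⟩ : ∃ w : E3, w = v := ⟨v, rfl⟩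
  have hs : ContMDiffOn (𝓡 3) ((𝓡 3).prod 𝓘(ℝ, E3)) (⊤ : ℕ∞)
      (fun y => (TotalSpace.mk' E3 y (coordFrame x y w) : TangentBundle (𝓡 3) M))
      (chartAt E3 x).source := by
    intro y hy
    have h := (Trivialization.contMDiffAt_symmL (IB := 𝓡 3) (n := (⊤ : ℕ∞))
      (trivializationAt E3 (TangentSpace (𝓡 3)) x) (mem_baseSet_of_mem_source hy))
    have hc : ContMDiffAt (𝓡 3) ((𝓡 3).prod 𝓘(ℝ, E3)) (⊤ : ℕ∞)
        (fun m : M => TotalSpace.mk' E3 (E := Trivial M E3) m w) y := by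
      rw [contMDiffAt_section]
      exact contMDiffAt_const
    exact (h.clm_bundle_apply hc).contMDiffWithinAt
  refine ⟨⟨fun y => φ y • coordFrame x y w, ?_⟩, ?_⟩
  · exact φ.contMDiff.contMDiffOn.smul_section_of_tsupport (chartAt E3 x).open_source hφ hs
  · change φ x • coordFrame x x w = v
    rw [φ.eq_one, one_smul]
    exact (coordFrame_self x w).trans hw

end Calculus

/-! ### The bundle of oriented orthonormal coframes of a coframe atlas -/

section Atlas

open Bundle Topology

instance {M : Type*} [TopologicalSpace M] [ChartedSpace E3 M] (x : M) :
    FiniteDimensional ℝ (TangentSpace (𝓡 3) x) := inferInstanceAs (FiniteDimensional ℝ E3)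

instance {M : Type*} [TopologicalSpace M] [ChartedSpace E3 M] (x : M) :
    T2Space (TangentSpace (𝓡 3) x) := inferInstanceAs (T2Space E3)

theorem finrank_tangentSpace {M : Type*} [TopologicalSpace M] [ChartedSpace E3 M] (x : M) :
    Module.finrank ℝ (TangentSpace (𝓡 3) x) = 3 :=
  (finrank_euclideanSpace_fin : Module.finrank ℝ E3 = 3)

theorem so3_inv_mulVec_mulVec (R : SO3) (v : Fin 3 → ℝ) : (R⁻¹).1 *ᵥ (R.1 *ᵥ v) = v :=
  (so3Equiv R).symm_apply_apply v

theorem so3_mulVec_inv_mulVec (R : SO3) (v : Fin 3 → ℝ) : R.1 *ᵥ ((R⁻¹).1 *ᵥ v) = v :=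
  (so3Equiv R).apply_symm_apply v

/-- Smooth local coframes over an open cover, whose transition functions are smooth with values in
`SO(3)`. They are the orthonormal frames of an oriented Riemannian metric. -/
structure CoframeAtlas (ι : Type*) (M : Type*) [TopologicalSpace M] [ChartedSpace E3 M]
    [IsManifold (𝓡 3) (⊤ : ℕ∞) M] where
  U : ι → Set M
  isOpen : ∀ a, IsOpen (U a)
  index : M → ι
  mem_index : ∀ x, x ∈ U (index x)
  e : ι → Fin 3 → OneForm M
  smooth_e : ∀ a i, (e a i).SmoothOn (U a)
  nondegenerate : ∀ a, ∀ x ∈ U a, ∀ v : TangentSpace (𝓡 3) x, (∀ i, e a i x v = 0) → v = 0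
  g : ι → ι → M → SO3
  smooth_g : ∀ a b i j, ContMDiffOn (𝓡 3) 𝓘(ℝ, ℝ) (⊤ : ℕ∞) (fun x => (g a b x).1 i j) (U a ∩ U b)
  e_eq : ∀ a b, ∀ x ∈ U a ∩ U b, ∀ v : TangentSpace (𝓡 3) x,
    (fun i => e a i x v) = (g a b x).1 *ᵥ fun i => e b i x v

namespace CoframeAtlas

variable {ι : Type*} {M : Type*} [TopologicalSpace M] [ChartedSpace E3 M]
    [IsManifold (𝓡 3) (⊤ : ℕ∞) M] (S : CoframeAtlas ι M)

/-- A local coframe at a point, as an isomorphism from the tangent space to `ℝ³`. -/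
noncomputable def frame {a : ι} {x : M} (hx : x ∈ S.U a) :
    TangentSpace (𝓡 3) x ≃L[ℝ] (Fin 3 → ℝ) :=
  (LinearMap.linearEquivOfInjective
    (LinearMap.pi fun i => (S.e a i x : TangentSpace (𝓡 3) x →ₗ[ℝ] ℝ))
    (LinearMap.ker_eq_bot.1 (LinearMap.ker_eq_bot'.2 fun v hv =>
      S.nondegenerate a x hx v fun i => congrFun hv i))
    (by rw [finrank_tangentSpace, Module.finrank_fin_fun])).toContinuousLinearEquiv

theorem frame_apply {a : ι} {x : M} (hx : x ∈ S.U a) (v : TangentSpace (𝓡 3) x) (i : Fin 3) :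
    S.frame hx v i = S.e a i x v := rfl

theorem frame_eq_mulVec {a b : ι} {x : M} (ha : x ∈ S.U a) (hb : x ∈ S.U b)
    (v : TangentSpace (𝓡 3) x) : S.frame ha v = (S.g a b x).1 *ᵥ S.frame hb v :=
  S.e_eq a b x ⟨ha, hb⟩ v

theorem frame_eq_trans {a b : ι} {x : M} (ha : x ∈ S.U a) (hb : x ∈ S.U b) :
    S.frame ha = (S.frame hb).trans (so3Equiv (S.g a b x)) :=
  ContinuousLinearEquiv.ext (funext fun v => S.frame_eq_mulVec ha hb v)

/-- The scalar product `∑ e^i ⊗ e^i` given by a coframe. -/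
noncomputable def innerOf (a : ι) (x : M) :
    TangentSpace (𝓡 3) x →L[ℝ] TangentSpace (𝓡 3) x →L[ℝ] ℝ :=
  ∑ i, (S.e a i x).smulRight (S.e a i x)

theorem innerOf_apply (a : ι) (x : M) (v w : TangentSpace (𝓡 3) x) :
    S.innerOf a x v w = ∑ i, S.e a i x v * S.e a i x w := by
  simp [innerOf]

/-- The scalar product does not depend on the coframe, as the transition functions are
orthogonal. -/
theorem innerOf_eq {a b : ι} {x : M} (ha : x ∈ S.U a) (hb : x ∈ S.U b) :
    S.innerOf a x = S.innerOf b x := by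
  refine ContinuousLinearMap.ext fun v => ContinuousLinearMap.ext fun w => ?_
  rw [innerOf_apply, innerOf_apply]
  have h := so3Equiv_dot (S.g a b x) (S.frame hb v) (S.frame hb w)
  rw [so3Equiv_apply, so3Equiv_apply, ← S.frame_eq_mulVec ha hb, ← S.frame_eq_mulVec ha hb] at h
  exact h

theorem contMDiffAt_innerOf {a : ι} {x : M} (hx : x ∈ S.U a) :
    ContMDiffAt (𝓡 3) ((𝓡 3).prod 𝓘(ℝ, E3 →L[ℝ] E3 →L[ℝ] ℝ)) (⊤ : ℕ∞)
      (fun y => (TotalSpace.mk' (E3 →L[ℝ] E3 →L[ℝ] ℝ) y (S.innerOf a y) :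
        TotalSpace (E3 →L[ℝ] E3 →L[ℝ] ℝ) fun x : M =>
          TangentSpace (𝓡 3) x →L[ℝ] TangentSpace (𝓡 3) x →L[ℝ] ℝ)) x := by
  rw [contMDiffAt_hom_bundle]
  refine ⟨contMDiffAt_id, ?_⟩
  have h : ContMDiffAt (𝓡 3) 𝓘(ℝ, E3 →L[ℝ] E3 →L[ℝ] ℝ) (⊤ : ℕ∞)
      (fun y => ∑ i, (formCoord (S.e a i) x y).smulRight (formCoord (S.e a i) x y)) x := by
    refine contMDiffAt_finsetSum fun i _ => ?_
    have hi := (OneForm.smoothOn_iff (S.isOpen a)).1 (S.smooth_e a i) x hx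
    have hb : ContDiff ℝ (⊤ : ℕ∞) fun p : (E3 →L[ℝ] ℝ) × (E3 →L[ℝ] ℝ) => p.1.smulRight p.2 :=
      isBoundedBilinearMap_smulRight.contDiff
    exact hb.contMDiff.contMDiffAt.comp x (hi.prodMk_space hi)
  refine h.congr_of_eventuallyEq ?_
  filter_upwards [eventually_mem_chart_source x] with y hy
  refine ContinuousLinearMap.ext fun v => ContinuousLinearMap.ext fun w => ?_
  have hy' : y ∈ (trivializationAt (E3 →L[ℝ] ℝ)
      (fun x : M => TangentSpace (𝓡 3) x →L[ℝ] ℝ) x).baseSet := by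
    simpa [hom_trivializationAt_baseSet] using hy
  change (Trivialization.continuousLinearMapAt ℝ (trivializationAt (E3 →L[ℝ] ℝ)
      (fun x : M => TangentSpace (𝓡 3) x →L[ℝ] ℝ) x) y (S.innerOf a y (coordFrame x y v))) w = _
  rw [Trivialization.continuousLinearMapAt_apply_of_mem ℝ _ hy', hom_trivializationAt_apply]
  have e1 : (ContinuousLinearMap.inCoordinates E3 (TangentSpace (𝓡 3)) ℝ (Trivial M ℝ) x y x y
      (S.innerOf a y (coordFrame x y v))) w =
      S.innerOf a y (coordFrame x y v) (coordFrame x y w) := by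
    simp [ContinuousLinearMap.inCoordinates, coordFrame]
  refine e1.trans ?_
  rw [innerOf_apply]
  simp [formCoord]

/-- The orientation given by a coframe. -/
noncomputable def orientOf {a : ι} {x : M} (hx : x ∈ S.U a) :
    Orientation ℝ (TangentSpace (𝓡 3) x) (Fin 3) :=
  Orientation.map (Fin 3) (S.frame hx).symm.toLinearEquiv (Pi.basisFun ℝ (Fin 3)).orientation

theorem map_frame_orientOf {a : ι} {x : M} (hx : x ∈ S.U a) :
    Orientation.map (Fin 3) (S.frame hx).toLinearEquiv (S.orientOf hx) =
      (Pi.basisFun ℝ (Fin 3)).orientation :=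
  (Orientation.map (Fin 3) (S.frame hx).toLinearEquiv).apply_symm_apply _

/-- The orientation does not depend on the coframe, as the transition functions have positive
determinant. -/
theorem orientOf_eq {a b : ι} {x : M} (ha : x ∈ S.U a) (hb : x ∈ S.U b) :
    S.orientOf ha = S.orientOf hb := by
  apply (Orientation.map (Fin 3) (S.frame ha).toLinearEquiv).injective
  rw [map_frame_orientOf, S.frame_eq_trans ha hb, orientation_map_trans, map_frame_orientOf,
    so3Equiv_orientation]

/-- The oriented Riemannian metric for which the local coframes are oriented and orthonormal. -/
noncomputable def orientedMetric : OrientedMetric M where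
  metric :=
    { inner := fun x => S.innerOf (S.index x) x
      symm := fun x v w => by
        rw [innerOf_apply, innerOf_apply]
        exact Finset.sum_congr rfl fun i _ => mul_comm _ _
      pos := fun x v hv => by
        rw [innerOf_apply]
        obtain ⟨i, hi⟩ : ∃ i, S.e (S.index x) i x v ≠ 0 := by
          by_contra! h
          exact hv (S.nondegenerate _ x (S.mem_index x) v h)
        exact Finset.sum_pos' (fun i _ => mul_self_nonneg _)
          ⟨i, Finset.mem_univ i, mul_self_pos.2 hi⟩
      isVonNBounded := fun x => by
        have hb : Bornology.IsVonNBounded ℝ (Metric.closedBall (0 : Fin 3 → ℝ) 1) :=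
          NormedSpace.isVonNBounded_closedBall ℝ _ _
        have h := hb.image ((S.frame (S.mem_index x)).symm :
          (Fin 3 → ℝ) →L[ℝ] TangentSpace (𝓡 3) x)
        refine h.subset fun v hv => (Set.mem_image _ _ _).2 ⟨S.frame (S.mem_index x) v, ?_,
          (S.frame (S.mem_index x)).symm_apply_apply v⟩
        have hv' : ∑ i, S.e (S.index x) i x v * S.e (S.index x) i x v < 1 := by
          rw [← innerOf_apply]; exact hv
        rw [mem_closedBall_zero_iff, pi_norm_le_iff_of_nonneg zero_le_one]
        intro i
        rw [frame_apply, Real.norm_eq_abs]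
        refine abs_le_one_iff_mul_self_le_one.2 (le_trans ?_ hv'.le)
        exact Finset.single_le_sum (f := fun i => S.e (S.index x) i x v * S.e (S.index x) i x v)
          (fun i _ => mul_self_nonneg _) (Finset.mem_univ i)
      contMDiff := fun x => by
        refine (S.contMDiffAt_innerOf (S.mem_index x)).congr_of_eventuallyEq ?_
        filter_upwards [(S.isOpen _).mem_nhds (S.mem_index x)] with y hy
        rw [S.innerOf_eq hy (S.mem_index y)] }
  orient := fun x => S.orientOf (S.mem_index x)
  continuous_orient := fun x => ⟨S.U (S.index x), S.isOpen _, S.mem_index x, S.e (S.index x),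
    S.smooth_e _, fun y hy => ⟨S.frame hy, fun v i => rfl, by
      rw [S.orientOf_eq (S.mem_index y) hy, map_frame_orientOf]⟩⟩

theorem inner_eq {a : ι} {x : M} (hx : x ∈ S.U a) (v w : TangentSpace (𝓡 3) x) :
    S.orientedMetric.metric.inner x v w = ∑ i, S.frame hx v i * S.frame hx w i := by
  change S.innerOf (S.index x) x v w = _
  rw [S.innerOf_eq (S.mem_index x) hx, innerOf_apply]
  rfl

theorem map_frame_orient {a : ι} {x : M} (hx : x ∈ S.U a) :
    Orientation.map (Fin 3) (S.frame hx).toLinearEquiv (S.orientedMetric.orient x) =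
      (Pi.basisFun ℝ (Fin 3)).orientation := by
  change Orientation.map (Fin 3) (S.frame hx).toLinearEquiv (S.orientOf (S.mem_index x)) = _
  rw [S.orientOf_eq (S.mem_index x) hx, map_frame_orientOf]

/-- The coframe `R⁻¹ e_a` at a point of `U_a`, i.e. the local coframe moved by the right action of
`R`. -/
noncomputable def coframe {a : ι} {x : M} (hx : x ∈ S.U a) (R : SO3) : Coframe S.orientedMetric where
  base := x
  frame := (S.frame hx).trans (so3Equiv R⁻¹)
  orthonormal v w := by
    rw [S.inner_eq hx]
    exact (so3Equiv_dot R⁻¹ (S.frame hx v) (S.frame hx w)).symm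
  oriented := by
    rw [orientation_map_trans, map_frame_orient, so3Equiv_orientation]

/-- The linear map which sends one oriented orthonormal coframe to another one is a rotation. -/
theorem exists_rotation {a : ι} (c : Coframe S.orientedMetric) (hc : c.base ∈ S.U a) :
    ∃ R : SO3, ∀ v, S.frame hc v = R.1 *ᵥ c.frame v := by
  set L := c.frame.symm.trans (S.frame hc) with hL
  have hdot (v w : Fin 3 → ℝ) : L v ⬝ᵥ L w = v ⬝ᵥ w := by
    have h1 := S.inner_eq hc (c.frame.symm v) (c.frame.symm w)
    rw [c.orthonormal] at h1
    simpa [hL, dotProduct] using h1.symm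
  have hmul (v : Fin 3 → ℝ) :
      LinearMap.toMatrix' (L : (Fin 3 → ℝ) →ₗ[ℝ] (Fin 3 → ℝ)) *ᵥ v = L v := by
    rw [← Matrix.toLin'_apply, Matrix.toLin'_toMatrix']; rfl
  have horient : Orientation.map (Fin 3) L.toLinearEquiv (Pi.basisFun ℝ (Fin 3)).orientation =
      (Pi.basisFun ℝ (Fin 3)).orientation := by
    have h1 : c.frame.trans L = S.frame hc :=
      ContinuousLinearEquiv.ext (funext fun v => by simp [hL])
    have h2 := orientation_map_trans c.frame L (S.orientedMetric.orient c.base)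
    rw [h1, c.oriented, map_frame_orient] at h2
    exact h2.symm
  have hdet : 0 < (LinearMap.toMatrix' (L : (Fin 3 → ℝ) →ₗ[ℝ] (Fin 3 → ℝ))).det := by
    rw [Orientation.map_eq_iff_det_pos _ _ (by simp)] at horient
    rwa [LinearMap.det_toMatrix']
  have horth : (LinearMap.toMatrix' (L : (Fin 3 → ℝ) →ₗ[ℝ] (Fin 3 → ℝ)))ᵀ *
      LinearMap.toMatrix' (L : (Fin 3 → ℝ) →ₗ[ℝ] (Fin 3 → ℝ)) = 1 := by
    refine Matrix.ext_of_mulVec_single fun j => ?_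
    refine dotProduct_eq _ _ fun w => ?_
    rw [← Matrix.mulVec_mulVec, Matrix.mulVec_transpose, ← Matrix.dotProduct_mulVec, hmul, hmul,
      hdot, Matrix.one_mulVec]
  have hsq : (LinearMap.toMatrix' (L : (Fin 3 → ℝ) →ₗ[ℝ] (Fin 3 → ℝ))).det = 1 := by
    have h3 := congrArg Matrix.det horth
    rw [Matrix.det_mul, Matrix.det_transpose, Matrix.det_one] at h3
    nlinarith
  refine ⟨⟨LinearMap.toMatrix' (L : (Fin 3 → ℝ) →ₗ[ℝ] (Fin 3 → ℝ)),
    (Matrix.mem_orthogonalGroup_iff' (Fin 3) ℝ).2 horth, hsq⟩, fun v => ?_⟩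
  rw [hmul, hL]
  simp

open Classical in
/-- The rotation which sends an orthonormal coframe to the local one; over points outside of `U_a`,
the unit. -/
noncomputable def rotation (a : ι) (c : Coframe S.orientedMetric) : SO3 :=
  if hc : c.base ∈ S.U a then (S.exists_rotation c hc).choose else 1

theorem rotation_spec {a : ι} (c : Coframe S.orientedMetric) (hc : c.base ∈ S.U a)
    (v : TangentSpace (𝓡 3) c.base) : S.frame hc v = (S.rotation a c).1 *ᵥ c.frame v := by
  rw [rotation, dif_pos hc]
  exact (S.exists_rotation c hc).choose_spec v

theorem rotation_apply {a : ι} (c : Coframe S.orientedMetric) (hc : c.base ∈ S.U a)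
    (i j : Fin 3) : (S.rotation a c).1 i j = S.e a i c.base (c.frame.symm (Pi.single j 1)) := by
  have h := congrFun (S.rotation_spec c hc (c.frame.symm (Pi.single j 1))) i
  rw [ContinuousLinearEquiv.apply_symm_apply, Matrix.mulVec_single_one] at h
  exact h.symm

theorem rotation_eq {a : ι} (c : Coframe S.orientedMetric) (hc : c.base ∈ S.U a) (R : SO3)
    (h : ∀ v, S.frame hc v = R.1 *ᵥ c.frame v) : S.rotation a c = R := by
  refine Subtype.ext (Matrix.ext fun i j => ?_)
  rw [S.rotation_apply c hc]
  have h' := congrFun (h (c.frame.symm (Pi.single j 1))) i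
  rw [ContinuousLinearEquiv.apply_symm_apply, Matrix.mulVec_single_one] at h'
  exact h'

theorem rotation_coframe {a : ι} {x : M} (hx : x ∈ S.U a) (R : SO3) :
    S.rotation a (S.coframe hx R) = R :=
  S.rotation_eq (S.coframe hx R) hx R fun _ => (so3_mulVec_inv_mulVec R _).symm

theorem coframe_rotation {a : ι} (c : Coframe S.orientedMetric) (hc : c.base ∈ S.U a) :
    S.coframe hc (S.rotation a c) = c := by
  refine Coframe.ext_frame rfl fun v => ?_
  refine (congrArg ((S.rotation a c)⁻¹.1 *ᵥ ·) (S.rotation_spec c hc v)).trans ?_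
  exact so3_inv_mulVec_mulVec _ _

theorem rotation_smul {a : ι} (c : Coframe S.orientedMetric) (hc : c.base ∈ S.U a) (R : SO3) :
    S.rotation a (MulOpposite.op R • c) = S.rotation a c * R := by
  refine S.rotation_eq (MulOpposite.op R • c) hc _ fun v => ?_
  refine (S.rotation_spec c hc v).trans ?_
  change _ = ((S.rotation a c).1 * R.1) *ᵥ ((R⁻¹).1 *ᵥ c.frame v)
  rw [← Matrix.mulVec_mulVec, so3_mulVec_inv_mulVec]

theorem rotation_coframe_eq_g {a b : ι} {x : M} (ha : x ∈ S.U a) (hb : x ∈ S.U b) (R : SO3) :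
    S.rotation a (S.coframe hb R) = S.g a b x * R := by
  refine S.rotation_eq (S.coframe hb R) ha _ fun v => ?_
  refine (S.frame_eq_mulVec ha hb v).trans ?_
  change _ = ((S.g a b x).1 * R.1) *ᵥ ((R⁻¹).1 *ᵥ S.frame hb v)
  rw [← Matrix.mulVec_mulVec, so3_mulVec_inv_mulVec]

end CoframeAtlas

/-- Continuity of a map to the coframe bundle in the coordinates of a chart. -/
theorem Coframe.continuousAt_iff {M : Type*} [TopologicalSpace M] [ChartedSpace E3 M]
    [IsManifold (𝓡 3) (⊤ : ℕ∞) M] {N : OrientedMetric M} {Z : Type*} [TopologicalSpace Z]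
    {f : Z → Coframe N} {z : Z} :
    ContinuousAt f z ↔ ContinuousAt (fun y => (f y).base) z ∧
      ContinuousAt (fun y => (((f y).frame : TangentSpace (𝓡 3) (f y).base →L[ℝ] (Fin 3 → ℝ)).comp
        (coordFrame (f z).base (f y).base) : E3 →L[ℝ] (Fin 3 → ℝ))) z := by
  rw [(Topology.IsInducing.induced (fun c : Coframe N =>
    (TotalSpace.mk' (E3 →L[ℝ] (Fin 3 → ℝ)) c.base
        (c.frame : TangentSpace (𝓡 3) c.base →L[ℝ] (Fin 3 → ℝ)) :
      TotalSpace (E3 →L[ℝ] (Fin 3 → ℝ))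
        (fun x : M => TangentSpace (𝓡 3) x →L[ℝ] (Fin 3 → ℝ))))).continuousAt_iff]
  refine (continuousAt_hom_bundle (RingHom.id ℝ) (E₂ := Trivial M (Fin 3 → ℝ)) _).trans ?_
  refine and_congr Iff.rfl (iff_of_eq (congrArg (fun h => ContinuousAt h z) ?_))
  funext y
  refine ContinuousLinearMap.ext fun v => ?_
  simp [ContinuousLinearMap.inCoordinates, coordFrame]

end Atlas

/-! ### The principal bundle of a coframe atlas -/

section AtlasBundle

open Bundle Topology

theorem SO3.continuousAt_iff {Z : Type*} [TopologicalSpace Z] {f : Z → SO3} {z : Z} :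
    ContinuousAt f z ↔ ∀ i j, ContinuousAt (fun y => (f y).1 i j) z := by
  rw [Topology.IsInducing.subtypeVal.continuousAt_iff]
  exact continuousAt_pi.trans (forall_congr' fun i => continuousAt_pi)

theorem SO3.inv_apply (R : SO3) (i j : Fin 3) : (R⁻¹).1 i j = R.1 j i := by
  have h1 : R.1ᵀ * R.1 = 1 := (Matrix.mem_orthogonalGroup_iff' (Fin 3) ℝ).1 R.2.1
  have h2 : R.1 * (R⁻¹).1 = 1 := congrArg Subtype.val (mul_inv_cancel R)
  have h3 : R.1ᵀ = (R⁻¹).1 := left_inv_eq_right_inv h1 h2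
  rw [← h3, Matrix.transpose_apply]

namespace CoframeAtlas

variable {ι : Type*} {M : Type*} [TopologicalSpace M] [ChartedSpace E3 M]
    [IsManifold (𝓡 3) (⊤ : ℕ∞) M] (S : CoframeAtlas ι M)

theorem continuous_base : Continuous fun c : Coframe S.orientedMetric => c.base :=
  continuous_iff_continuousAt.2 fun _ => (Coframe.continuousAt_iff (f := id).1 continuousAt_id).1

/-- The matrix of the rotation is the local coframe composed with the inverse of the given one.
Both are continuous in the coordinates of a chart, and so is inversion of linear maps. -/
theorem continuousAt_rotation {a : ι} (c : Coframe S.orientedMetric) (hc : c.base ∈ S.U a) :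
    ContinuousAt (S.rotation a) c := by
  rw [SO3.continuousAt_iff]
  intro i j
  have hbase := S.continuous_base.continuousAt (x := c)
  have hframe := (Coframe.continuousAt_iff (f := id) (z := c).1 continuousAt_id).2
  simp only [id] at hframe
  have hK := ((OneForm.smoothOn_iff (S.isOpen a)).1 (S.smooth_e a i) c.base hc).continuousAt
  have hE : ContinuousAt (fun c' : Coframe S.orientedMetric =>
      formCoord (S.e a i) c.base c'.base) c :=
    ContinuousAt.comp (f := fun c' : Coframe S.orientedMetric => c'.base) hK hbase
  let e (c' : Coframe S.orientedMetric) (h : c'.base ∈ (chartAt E3 c.base).source) :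
      E3 ≃L[ℝ] (Fin 3 → ℝ) :=
    ((trivializationAt E3 (TangentSpace (𝓡 3)) c.base).continuousLinearEquivAt ℝ _
      (mem_baseSet_of_mem_source h)).symm.trans c'.frame
  have he (c' : Coframe S.orientedMetric) (h : c'.base ∈ (chartAt E3 c.base).source) :
      ((c'.frame : TangentSpace (𝓡 3) c'.base →L[ℝ] (Fin 3 → ℝ)).comp
        (coordFrame c.base c'.base) : E3 →L[ℝ] (Fin 3 → ℝ)) = (e c' h : E3 →L[ℝ] (Fin 3 → ℝ)) :=
    ContinuousLinearMap.ext fun v => congrArg c'.frame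
      (congrFun (Trivialization.symm_continuousLinearEquivAt_eq _
        (mem_baseSet_of_mem_source h)) v).symm
  have hinv : ContinuousAt (fun c' : Coframe S.orientedMetric =>
      ((c'.frame : TangentSpace (𝓡 3) c'.base →L[ℝ] (Fin 3 → ℝ)).comp
        (coordFrame c.base c'.base) : E3 →L[ℝ] (Fin 3 → ℝ)).inverse) c := by
    refine ContinuousAt.comp (g := ContinuousLinearMap.inverse) ?_ hframe
    have h := (contDiffAt_map_inverse (𝕜 := ℝ) (n := 0)
      (e c (mem_chart_source E3 c.base))).continuousAt
    rwa [← he c (mem_chart_source E3 c.base)] at h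
  refine (hE.clm_apply (hinv.clm_apply (continuousAt_const (y := Pi.single j 1)))).congr ?_
  filter_upwards [hbase.eventually_mem ((S.isOpen a).mem_nhds hc),
    hbase.eventually (eventually_mem_chart_source c.base)] with c' h1 h2
  rw [S.rotation_apply c' h1, he c' h2, ContinuousLinearMap.inverse_equiv]
  have h3 : coordFrame c.base c'.base ((e c' h2).symm (Pi.single j 1)) =
      c'.frame.symm (Pi.single j 1) := by
    have h4 : c'.frame (coordFrame c.base c'.base ((e c' h2).symm (Pi.single j 1))) =
        Pi.single j 1 :=
      (DFunLike.congr_fun (he c' h2) _).trans ((e c' h2).apply_symm_apply _)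
    exact (c'.frame.eq_symm_apply).2 h4
  exact congrArg (S.e a i c'.base) h3

open Classical in
/-- The coframe `R⁻¹ e_a`; over points outside of `U_a`, any other coframe. -/
noncomputable def coframeAt (a : ι) (p : M × SO3) : Coframe S.orientedMetric :=
  if h : p.1 ∈ S.U a then S.coframe h p.2 else S.coframe (S.mem_index p.1) p.2

theorem coframeAt_of_mem {a : ι} {p : M × SO3} (h : p.1 ∈ S.U a) :
    S.coframeAt a p = S.coframe h p.2 := dif_pos h

theorem base_coframeAt (a : ι) (p : M × SO3) : (S.coframeAt a p).base = p.1 := by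
  rw [coframeAt]
  split_ifs <;> rfl

theorem frame_coframeAt {a : ι} {p : M × SO3} (h : p.1 ∈ S.U a) (v : E3) (i : Fin 3) :
    (S.coframeAt a p).frame v i = ∑ j, (p.2⁻¹).1 i j * S.e a j p.1 v := by
  rw [S.coframeAt_of_mem h]
  rfl

theorem continuousAt_coframeAt {a : ι} (p : M × SO3) (hp : p.1 ∈ S.U a) :
    ContinuousAt (S.coframeAt a) p := by
  rw [Coframe.continuousAt_iff]
  simp only [base_coframeAt]
  refine ⟨continuousAt_fst, ?_⟩
  rw [continuousAt_clm_apply]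
  intro v
  refine continuousAt_pi.2 fun i => ?_
  have h : ContinuousAt (fun q : M × SO3 =>
      ∑ j, (q.2⁻¹).1 i j * formCoord (S.e a j) p.1 q.1 v) p := by
    refine tendsto_finsetSum _ fun j _ => ContinuousAt.mul ?_ ?_
    · simp only [SO3.inv_apply]
      exact SO3.continuousAt_iff.1 continuousAt_snd j i
    · have hK := ((OneForm.smoothOn_iff (S.isOpen a)).1 (S.smooth_e a j) p.1 hp).continuousAt
      exact (ContinuousAt.comp (f := fun q : M × SO3 => q.1) hK continuousAt_fst).clm_apply
        continuousAt_const
  refine h.congr ?_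
  filter_upwards [continuousAt_fst.eventually_mem ((S.isOpen a).mem_nhds hp)] with q hq
  have h2 (w : M) (hw : (S.coframeAt a q).base = w) :
      (S.coframeAt a q).frame (coordFrame p.1 (S.coframeAt a q).base v) i =
      (S.coframeAt a q).frame (show E3 from coordFrame p.1 w v) i := by
    subst hw; rfl
  exact ((h2 q.1 (S.base_coframeAt a q)).trans (S.frame_coframeAt hq _ i)).symm

/-- The trivialization of the coframe bundle given by a local coframe. -/
noncomputable def trivialization (a : ι) :
    Trivialization SO3 (fun c : Coframe S.orientedMetric => c.base) where
  toFun c := (c.base, S.rotation a c)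
  invFun := S.coframeAt a
  source := {c | c.base ∈ S.U a}
  target := S.U a ×ˢ Set.univ
  map_source' c hc := ⟨hc, trivial⟩
  map_target' p hp := by
    change (S.coframeAt a p).base ∈ S.U a
    rw [S.base_coframeAt]; exact hp.1
  left_inv' c hc := by
    rw [S.coframeAt_of_mem (p := (c.base, S.rotation a c)) hc]
    exact S.coframe_rotation c hc
  right_inv' p hp := by
    rw [S.coframeAt_of_mem hp.1]
    exact Prod.ext rfl (S.rotation_coframe hp.1 p.2)
  open_source := (S.isOpen a).preimage S.continuous_base
  open_target := (S.isOpen a).prod isOpen_univ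
  continuousOn_toFun c hc :=
    (S.continuous_base.continuousAt.prodMk (S.continuousAt_rotation c hc)).continuousWithinAt
  continuousOn_invFun p hp := (S.continuousAt_coframeAt p hp.1).continuousWithinAt
  baseSet := S.U a
  open_baseSet := S.isOpen a
  source_eq := rfl
  target_eq := rfl
  proj_toFun _ _ := rfl

/-- The principal bundle of oriented orthonormal coframes. -/
noncomputable def bundle : PrincipalBundle SO3 SO3.coords ι M (Coframe S.orientedMetric) where
  proj c := c.base
  triv := S.trivialization
  cover x := ⟨S.index x, S.mem_index x⟩
  equivariant a c R hc := ⟨hc, Prod.ext rfl (S.rotation_smul c hc R)⟩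
  smooth_transition a b := by
    refine contMDiffOn_pi_space.2 fun i => contMDiffOn_pi_space.2 fun j => ?_
    refine (S.smooth_g a b i j).congr fun x hx => ?_
    change (S.rotation a (S.coframeAt b (x, 1))).1 i j = _
    rw [S.coframeAt_of_mem (p := (x, 1)) hx.2, S.rotation_coframe_eq_g hx.1 hx.2, mul_one]

theorem transition_bundle {a b : ι} {x : M} (hx : x ∈ S.U a ∩ S.U b) :
    S.bundle.transition a b x = S.g a b x := by
  change S.rotation a (S.coframeAt b (x, 1)) = _
  rw [S.coframeAt_of_mem (p := (x, 1)) hx.2, S.rotation_coframe_eq_g hx.1 hx.2, mul_one]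

/-- A spin connection in the local frames makes the base a Riemann-Cartan manifold. -/
noncomputable def coframeBundle (w : ι → Fin 3 → Fin 3 → OneForm M)
    (smooth : ∀ a i j, (w a i j).SmoothOn (S.U a))
    (antisymm : ∀ a i j x, w a i j x = -w a j i x)
    (transform : ∀ a b, ∀ x ∈ S.U a ∩ S.U b, ∀ v : TangentSpace (𝓡 3) x,
      Matrix.of (fun i j => w b i j x v) =
        ((S.g a b x)⁻¹).1 * Matrix.of (fun i j => w a i j x v) * (S.g a b x).1
        + ((S.g a b x)⁻¹).1 * Matrix.of (fun i j =>
          (mfderiv (𝓡 3) 𝓘(ℝ, ℝ) (fun y => (S.g a b y).1 i j) x v : ℝ))) :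
    CoframeBundle ι M where
  geometry := S.orientedMetric
  bundle := S.bundle
  proj_eq _ := rfl
  connection :=
    { spin := w
      smooth := smooth
      antisymm := fun a i j x _ => antisymm a i j x
      transform := fun a b x hx v => by
        have h (i j : Fin 3) : (fun y => (S.bundle.transition a b y).1 i j) =ᶠ[𝓝 x]
            fun y => (S.g a b y).1 i j := by
          filter_upwards [((S.isOpen a).inter (S.isOpen b)).mem_nhds hx] with y hy
          rw [S.transition_bundle hy]
        have h' (i j : Fin 3) :
            (mfderiv (𝓡 3) 𝓘(ℝ, ℝ) (fun y => (S.bundle.transition a b y).1 i j) x v : ℝ) =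
            (mfderiv (𝓡 3) 𝓘(ℝ, ℝ) (fun y => (S.g a b y).1 i j) x v : ℝ) :=
          DFunLike.congr_fun (h i j).mfderiv_eq v
        rw [transform a b x hx v, S.transition_bundle hx]
        refine congrArg (fun m => ((S.g a b x)⁻¹).1 * Matrix.of (fun i j => w a i j x v) * (S.g a b x).1 +
          ((S.g a b x)⁻¹).1 * m) (Matrix.ext fun i j => ?_)
        exact (h' i j).symm }
  e := S.e
  smooth_e := S.smooth_e
  soldering a c hc v i := congrFun (S.rotation_spec c hc v) i

end CoframeAtlas

end AtlasBundle

/-! ### From gauge fields to spin connection, curvature and torsion -/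

section GaugeFields

open Topology

variable {M : Type*} [TopologicalSpace M] [ChartedSpace E3 M]

/-- The spin connection `ω^{ij} = -ε^{ijk} A_k`. -/
noncomputable def spinForm (A : Fin 3 → OneForm M) (i j : Fin 3) : OneForm M :=
  fun x => ∑ k, (-eps i j k) • A k x

theorem spinForm_apply (A : Fin 3 → OneForm M) (i j : Fin 3) (x : M) (v : TangentSpace (𝓡 3) x) :
    spinForm A i j x v = adMatrix (fun k => A k x v) i j := by
  simp [spinForm, adMatrix]

theorem eps_swap (i j k : Fin 3) : eps j i k = -eps i j k := by
  simp only [eps]; ring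

theorem spinForm_antisymm (A : Fin 3 → OneForm M) (i j : Fin 3) (x : M) :
    spinForm A i j x = -spinForm A j i x := by
  refine ContinuousLinearMap.ext fun v => ?_
  rw [neg_apply, spinForm_apply, spinForm_apply, adMatrix_apply, adMatrix_apply]
  simp only [eps_swap i j]
  simp

/-- The covariant derivative in terms of the adjoint action, `Dζ = dζ + ad(A) ζ`. -/
theorem covD_apply (A : Fin 3 → OneForm M) (ζ : Fin 3 → M → ℝ) (i : Fin 3) (x : M)
    (v : TangentSpace (𝓡 3) x) :
    covD A ζ i x v = dFun (ζ i) x v + (adMatrix (fun k => A k x v) *ᵥ fun j => ζ j x) i := by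
  simp only [covD, add_apply, sum_apply, smul_apply, smul_eq_mul, Matrix.mulVec, dotProduct,
    adMatrix_apply]
  fin_cases i <;> simp [Fin.sum_univ_three, eps] <;> ring

theorem eq_sum_spinForm (A : Fin 3 → OneForm M) (k : Fin 3) (x : M) :
    A k x = (-(1 / 2) : ℝ) • ∑ i, ∑ j, eps k i j • spinForm A i j x := by
  refine ContinuousLinearMap.ext fun v => ?_
  simp only [sum_apply, smul_apply, smul_eq_mul, spinForm_apply, adMatrix_apply]
  fin_cases k <;> simp [Fin.sum_univ_three, eps] <;> ring

theorem dFun_sum_smul {κ : Type} {t : Finset κ} {f : κ → M → ℝ} (c : κ → ℝ) {x : M}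
    (hf : ∀ k, MDifferentiableAt (𝓡 3) 𝓘(ℝ, ℝ) (f k) x) :
    dFun (fun y => ∑ k ∈ t, c k * f k y) x = ∑ k ∈ t, c k • dFun (f k) x := by
  have hs : MDifferentiableAt (𝓡 3) 𝓘(ℝ, ℝ) (fun y => ∑ k ∈ t, c k * f k y) x := by
    have h := MDifferentiableAt.sum (t := t) fun k _ => (hf k).const_smul (c k)
    convert h using 1
    ext y
    simp
  refine ContinuousLinearMap.ext fun v => ?_
  have h1 := hasDerivAt_chartCurve hs v
  have h2 : HasDerivAt (fun s => ∑ k ∈ t, c k * f k (chartCurve x v s))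
      (∑ k ∈ t, c k * dFun (f k) x v) 0 :=
    HasDerivAt.fun_sum fun k _ => (hasDerivAt_chartCurve (hf k) v).const_mul (c k)
  refine (h1.unique h2).trans ?_
  simp

theorem dFun_const_mul {f : M → ℝ} (c : ℝ) {x : M}
    (hf : MDifferentiableAt (𝓡 3) 𝓘(ℝ, ℝ) f x) :
    dFun (fun y => c * f y) x = c • dFun f x := by
  have h := dFun_sum_smul (t := Finset.univ) (f := fun _ : Unit => f) (fun _ => c)
    (x := x) fun _ => hf
  simpa using h

theorem dFun_zero (x : M) : dFun (0 : M → ℝ) x = 0 := mfderiv_const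

/-- Gauge transformations of the stability part of the gauge field are local rotations of the spin
connection. -/
theorem deltaOmega_spinForm (A : Fin 3 → OneForm M) {α : Fin 3 → M → ℝ} {x : M}
    (hα : ∀ i, MDifferentiableAt (𝓡 3) 𝓘(ℝ, ℝ) (α i) x) (i j : Fin 3) :
    deltaOmega (spinForm A) (fun i j y => -∑ k, eps i j k * α k y) i j x =
      -∑ k, eps i j k • deltaA A α k x := by
  have h : (fun y => -∑ k, eps i j k * α k y) = fun y => ∑ k, (-eps i j k) * α k y := by
    funext y; simp
  refine ContinuousLinearMap.ext fun v => ?_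
  simp only [deltaOmega, deltaA, h, dFun_sum_smul _ hα, add_apply, neg_apply, sum_apply, smul_apply,
    smul_eq_mul, covD_apply, spinForm_apply, adMatrix_apply, Matrix.mulVec, dotProduct]
  fin_cases i <;> fin_cases j <;> simp [Fin.sum_univ_three, eps] <;> ring

/-- Gauge transformations of the coset part of the gauge field are local translations and rotations
of the coframe. -/
theorem deltaE_spinForm (A θ : Fin 3 → OneForm M) (μ : ℝ) {α ζ : Fin 3 → M → ℝ} {x : M}
    (hζ : ∀ i, MDifferentiableAt (𝓡 3) 𝓘(ℝ, ℝ) (ζ i) x) (i : Fin 3) :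
    deltaE (spinForm A) (fun i y => μ⁻¹ • θ i y) (fun i j y => -∑ k, eps i j k * α k y)
      (fun i y => μ⁻¹ * ζ i y) i x = μ⁻¹ • deltaTheta A θ α ζ i x := by
  refine ContinuousLinearMap.ext fun v => ?_
  simp only [deltaE, deltaTheta, dFun_const_mul _ (hζ i), add_apply, sub_apply, sum_apply,
    smul_apply, smul_eq_mul, covD_apply, spinForm_apply, adMatrix_apply, Matrix.mulVec, dotProduct]
  fin_cases i <;> simp [Fin.sum_univ_three, eps] <;> ring

variable [IsManifold (𝓡 3) (⊤ : ℕ∞) M]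

theorem smoothOn_spinForm {A : Fin 3 → OneForm M} {U : Set M} (hU : IsOpen U)
    (hA : ∀ i, (A i).SmoothOn U) (i j : Fin 3) : (spinForm A i j).SmoothOn U :=
  OneForm.SmoothOn.sum hU fun k => OneForm.SmoothOn.smul hU contMDiffOn_const (hA k)

/-- As `ε` is an invariant tensor, it carries the field strength of `A` to the curvature of the spin
connection. -/
theorem curvature_spinForm {A : Fin 3 → OneForm M} {U : Set M} (hU : IsOpen U)
    (hA : ∀ i, (A i).SmoothOn U) {x : M} (hx : x ∈ U) (i j : Fin 3) (u v : TangentSpace (𝓡 3) x) :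
    curvature (spinForm A) i j x u v = -∑ k, eps i j k * fieldF A k x u v := by
  have h : extD (spinForm A i j) x u v = ∑ k, (-eps i j k) * extD (A k) x u v :=
    extD_sum_smul hU hA hx u v
  simp only [curvature, h, fieldF, wedge, spinForm_apply, adMatrix_apply]
  fin_cases i <;> fin_cases j <;> simp [Fin.sum_univ_three, eps] <;> ring

theorem torsion_spinForm {A θ : Fin 3 → OneForm M} {U : Set M} (hU : IsOpen U)
    (hθ : ∀ i, (θ i).SmoothOn U) (μ : ℝ) {x : M} (hx : x ∈ U) (i : Fin 3)
    (u v : TangentSpace (𝓡 3) x) :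
    torsion (spinForm A) (fun i y => μ⁻¹ • θ i y) i x u v = μ⁻¹ * fieldPi A θ i x u v := by
  simp only [torsion, extD_smul_form hU (hθ i) hx, fieldPi, wedge, spinForm_apply, adMatrix_apply,
    smul_apply, smul_eq_mul]
  fin_cases i <;> simp [Fin.sum_univ_three, eps] <;> ring

/-- The Chern-Simons Lagrangian is the Einstein-Hilbert one. -/
theorem sum_wedge12_fieldF {A θ : Fin 3 → OneForm M} {U : Set M} (hU : IsOpen U)
    (hA : ∀ i, (A i).SmoothOn U) {μ : ℝ} (hμ : μ ≠ 0) {x : M} (hx : x ∈ U)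
    (u v w : TangentSpace (𝓡 3) x) :
    ∑ i, wedge12 (θ i) (fieldF A i) x u v w = -(μ / 2) * ∑ i, ∑ j, ∑ k,
      eps i j k * wedge12 (fun y => μ⁻¹ • θ i y) (curvature (spinForm A) j k) x u v w := by
  simp only [wedge12, curvature_spinForm hU hA hx, smul_apply, smul_eq_mul]
  simp only [Fin.sum_univ_three, eps]
  field_simp
  norm_num
  ring

/-- A diffeomorphism acts on the spin connection as a local rotation up to the curvature. -/
theorem lieD_spin_sub (X : VectorField M) {w : Fin 3 → Fin 3 → OneForm M} {U : Set M}
    (hU : IsOpen U) (hw : ∀ i j, (w i j).SmoothOn U) {x : M} (hx : x ∈ U)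
    (hanti : ∀ i j, w i j x = -w j i x) (i j : Fin 3) (v : TangentSpace (𝓡 3) x) :
    (lieD X (w i j) x - deltaOmega w 0 i j x) v -
      deltaOmega w (fun i j => interior X (w i j)) i j x v = curvature w i j x (X x) v := by
  have h0 : deltaOmega w 0 i j x = 0 := by
    have h := dFun_zero x
    simp only [deltaOmega, Pi.zero_apply, h]
    simp
  have ha (p q : Fin 3) (u : TangentSpace (𝓡 3) x) : w p q x u = -w q p x u := by
    rw [hanti p q, neg_apply]
  rw [h0, sub_zero, lieD_eq X hU (hw i j) hx]
  simp only [deltaOmega, add_apply, sum_apply, smul_apply, smul_eq_mul, curvature, wedge, interior]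
  have hs : ∑ k, (w i k x (X x) * w k j x v - w i k x v * w k j x (X x)) =
      -∑ k, (w k j x (X x) * w i k x v + w i k x (X x) * w j k x v) := by
    rw [← Finset.sum_neg_distrib]
    exact Finset.sum_congr rfl fun k _ => by rw [ha j k v]; ring
  rw [hs]
  ring

/-- A diffeomorphism acts on the coframe as a translation and a local rotation up to the torsion. -/
theorem lieD_coframe_sub (X : VectorField M) {w : Fin 3 → Fin 3 → OneForm M}
    {e : Fin 3 → OneForm M} {ϑ : Fin 3 → M → ℝ} {U : Set M} (hU : IsOpen U)
    (he : ∀ i, (e i).SmoothOn U) (hϑ : ∀ y ∈ U, ∀ i, ϑ i y = interior X (e i) y) {x : M}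
    (hx : x ∈ U) (i : Fin 3) (v : TangentSpace (𝓡 3) x) :
    (lieD X (e i) x - deltaE w e 0 ϑ i x) v -
      deltaE w e (fun i j => interior X (w i j)) 0 i x v = torsion w e i x (X x) v := by
  have h1 : dFun (ϑ i) x = dFun (interior X (e i)) x :=
    (Filter.eventuallyEq_of_mem (hU.mem_nhds hx) fun y hy => hϑ y hy i).mfderiv_eq
  have hz := dFun_zero x
  simp only [deltaE, sub_apply, add_apply, sum_apply, smul_apply, smul_eq_mul, Pi.zero_apply, h1, hz,
    lieD_eq X hU (he i) hx, hϑ x hx, torsion, wedge, interior, Finset.sum_sub_distrib]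
  simp
  simp only [mul_comm]
  ring

end GaugeFields

/-! ### Change of the local section -/

section Transform

open Topology

variable {M : Type*} [TopologicalSpace M] [ChartedSpace E3 M] [IsManifold (𝓡 3) (⊤ : ℕ∞) M]
  {P : Type*} [TopologicalSpace P] [MulAction Poincareᵐᵒᵖ P] {ι : Type*}
  {B : PrincipalBundle Poincare Poincare.coords ι M P}

/-- The transformation law of the stability potentials, pushed forward along `Γ₁`: it gives the
differential of the rotation matrices which relate two local sections. -/
theorem PoincareConnection.mfderiv_transition_Gamma1 (H : PoincareConnection B) {a b : ι} {x : M}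
    (hx : x ∈ B.domain a ∩ B.domain b) (v : TangentSpace (𝓡 3) x) (i j : Fin 3) :
    (mfderiv (𝓡 3) 𝓘(ℝ, ℝ) (fun y => (Gamma1 (B.transition a b y).rot).1 i j) x v : ℝ) =
      ((Gamma1 (B.transition a b x).rot).1 * adMatrix (fun k => H.A b k x v) -
        adMatrix (fun k => H.A a k x v) * (Gamma1 (B.transition a b x).rot).1) i j := by
  have hU := ((B.isOpen_domain a).inter (B.isOpen_domain b)).mem_nhds hx
  set u := (B.transition a b x).rot with hu
  have hR := ((contMDiffOn_transition_Gamma1 B a b i j).contMDiffAt hU).mdifferentiableAt (by simp)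
  have hr (k l : Fin 2) :=
    ((contMDiffOn_transition_rot B a b k l).contMDiffAt hU).mdifferentiableAt (by simp)
  have hA := H.transform_A a b x hx v
  set m : Matrix (Fin 2) (Fin 2) ℂ := Matrix.of (fun k l =>
    (mfderiv (𝓡 3) 𝓘(ℝ, ℂ) (fun y => (B.transition a b y).rot.1 k l) x v : ℂ)) with hm
  have h0 : (B.transition a b (chartCurve x v 0)).rot = u :=
    congrArg (fun y => (B.transition a b y).rot) (chartCurve_zero x v)
  have hu1 : u.1 * (u⁻¹).1 = 1 := congrArg Subtype.val (mul_inv_cancel u)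
  have hm' : m = u.1 * su2Alg (fun k => H.A b k x v) - su2Alg (fun k => H.A a k x v) * u.1 := by
    rw [hA, ← hu, mul_add, ← mul_assoc, ← mul_assoc, ← mul_assoc, hu1, one_mul, one_mul]
    abel
  have h := hasDerivAt_Gamma1_of_eq (γ := fun s => (B.transition a b (chartCurve x v s)).rot)
    (t := 0) (m := m) (fun k l => hasDerivAt_chartCurve (hr k l) v) (fun k => H.A a k x v)
    (fun k => H.A b k x v) (by simp only [h0]; exact hm') i j
  simp only [h0] at h
  exact (hasDerivAt_chartCurve hR v).unique h

/-- The `SO(3)` connection induced by the stability part of the gauge field. -/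
theorem PoincareConnection.spinForm_transform (H : PoincareConnection B) {a b : ι} {x : M}
    (hx : x ∈ B.domain a ∩ B.domain b) (v : TangentSpace (𝓡 3) x) :
    Matrix.of (fun i j => spinForm (H.A b) i j x v) =
      ((Gamma1 (B.transition a b x).rot)⁻¹).1 * Matrix.of (fun i j => spinForm (H.A a) i j x v) *
        (Gamma1 (B.transition a b x).rot).1
      + ((Gamma1 (B.transition a b x).rot)⁻¹).1 * Matrix.of (fun i j =>
        (mfderiv (𝓡 3) 𝓘(ℝ, ℝ) (fun y => (Gamma1 (B.transition a b y).rot).1 i j) x v : ℝ)) := by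
  have hs (c : ι) : Matrix.of (fun i j => spinForm (H.A c) i j x v) =
      adMatrix (fun k => H.A c k x v) := Matrix.ext fun i j => spinForm_apply _ i j x v
  have hd : Matrix.of (fun i j =>
      (mfderiv (𝓡 3) 𝓘(ℝ, ℝ) (fun y => (Gamma1 (B.transition a b y).rot).1 i j) x v : ℝ)) =
      (Gamma1 (B.transition a b x).rot).1 * adMatrix (fun k => H.A b k x v) -
        adMatrix (fun k => H.A a k x v) * (Gamma1 (B.transition a b x).rot).1 :=
    Matrix.ext fun i j => H.mfderiv_transition_Gamma1 hx v i j
  have hR : ((Gamma1 (B.transition a b x).rot)⁻¹).1 * (Gamma1 (B.transition a b x).rot).1 = 1 :=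
    congrArg Subtype.val (inv_mul_cancel (Gamma1 (B.transition a b x).rot))
  rw [hs, hs, hd, mul_sub, ← mul_assoc, hR, one_mul, mul_assoc]
  abel

namespace StabilitySubbundle

theorem smoothOn_theta (Q : StabilitySubbundle B) (H : PoincareConnection B) (a : ι) (i : Fin 3) :
    (Q.theta H a i).SmoothOn (B.domain a) := by
  have hU := B.isOpen_domain a
  refine (H.smooth_θ a i).add hU (.add hU (smoothOn_dFun hU (Q.contMDiffOn_s a i))
    (.sum hU fun j => .sum hU fun k => .smul hU ?_ (H.smooth_A a j)))
  exact contMDiffOn_const.mul (Q.contMDiffOn_s a k)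

/-- The section of the sub-bundle changes by an element of the stability group only, so that the
coset field is rotated, without an inhomogeneous term: it transforms as a local coframe. -/
theorem theta_transform (Q : StabilitySubbundle B) (H : PoincareConnection B) {a b : ι} {x : M}
    (hx : x ∈ B.domain a ∩ B.domain b) (v : TangentSpace (𝓡 3) x) :
    (fun i => Q.theta H a i x v) =
      (Gamma1 (B.transition a b x).rot).1 *ᵥ fun i => Q.theta H b i x v := by
  have hUo := (B.isOpen_domain a).inter (B.isOpen_domain b)
  have hU := hUo.mem_nhds hx
  set R := Gamma1 (B.transition a b x).rot with hR
  have hsd (c : ι) (hc : x ∈ B.domain c) (j : Fin 3) := ((Q.contMDiffOn_s c j).contMDiffAt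
    ((B.isOpen_domain c).mem_nhds hc)).mdifferentiableAt (by simp)
  have hwd (j : Fin 3) := ((contMDiffOn_pi_space.1 (contMDiffOn_transition_trans B a b) j).contMDiffAt
    hU).mdifferentiableAt (by simp)
  have hRd (i j : Fin 3) :=
    ((contMDiffOn_transition_Gamma1 B a b i j).contMDiffAt hU).mdifferentiableAt (by simp)
  -- The product rule for `s_a = w + R s_b`, along the curve with velocity `v`.
  have hds (i : Fin 3) : dFun (fun y => Q.s a y i) x v =
      dFun (fun y => (B.transition a b y).trans i) x v +
        ∑ j, ((R.1 * adMatrix (fun k => H.A b k x v) - adMatrix (fun k => H.A a k x v) * R.1) i j *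
          Q.s b x j + R.1 i j * dFun (fun y => Q.s b y j) x v) := by
    have h1 := hasDerivAt_chartCurve (hsd a hx.1 i) v
    have h2 := (hasDerivAt_chartCurve (hwd i) v).add (HasDerivAt.fun_sum (u := Finset.univ) fun j _ =>
      (hasDerivAt_chartCurve (hRd i j) v).mul (hasDerivAt_chartCurve (hsd b hx.2 j) v))
    have h3 := h2.congr_of_eventuallyEq (f₁ := fun t => Q.s a (chartCurve x v t) i) (by
      filter_upwards [eventually_chartCurve_mem hUo hx v] with t ht
      rw [Q.s_eq ht.1 ht.2]
      rfl)
    refine (h1.unique h3).trans ?_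
    have h0 : chartCurve x v 0 = x := chartCurve_zero x v
    exact congrArg (dFun (fun y => (B.transition a b y).trans i) x v + ·)
      (Finset.sum_congr rfl fun j _ => congrArg₂ (· + ·)
        (congrArg₂ (· * ·) (H.mfderiv_transition_Gamma1 hx v i j)
          (congrArg (fun y => Q.s b y j) h0))
        (congrArg (fun y => (Gamma1 (B.transition a b y).rot).1 i j *
          dFun (fun y => Q.s b y j) x v) h0))
  have hθ := H.transform_θ a b x hx v
  have hθ' : R.1 *ᵥ (fun i => H.θ b i x v) =
      fun i => H.θ a i x v + covD (H.A a) (fun j y => (B.transition a b y).trans j) i x v := by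
    rw [hθ, map_inv]
    exact so3_mulVec_inv_mulVec R _
  have hb : (fun i => Q.theta H b i x v) = (fun i => H.θ b i x v) +
      ((fun i => dFun (fun y => Q.s b y i) x v) + adMatrix (fun k => H.A b k x v) *ᵥ Q.s b x) := by
    funext i
    simp only [theta, add_apply, covD_apply]
    rfl
  rw [hb, Matrix.mulVec_add, hθ', Matrix.mulVec_add, Matrix.mulVec_mulVec]
  funext i
  simp only [theta, add_apply, covD_apply, hds, Pi.add_apply]
  have hs : (fun j => Q.s a x j) = (fun j => (B.transition a b x).trans j) + R.1 *ᵥ Q.s b x :=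
    Q.s_eq hx.1 hx.2
  rw [hs, Matrix.mulVec_add, Matrix.mulVec_mulVec, Finset.sum_add_distrib]
  have e1 : ∑ j, (R.1 * adMatrix (fun k => H.A b k x v) - adMatrix (fun k => H.A a k x v) * R.1) i j *
      Q.s b x j = ((R.1 * adMatrix (fun k => H.A b k x v)) *ᵥ Q.s b x) i -
        ((adMatrix (fun k => H.A a k x v) * R.1) *ᵥ Q.s b x) i := by
    rw [← Pi.sub_apply, ← Matrix.sub_mulVec]; rfl
  rw [e1, Pi.add_apply]
  simp only [Matrix.mulVec, dotProduct]
  ring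

end StabilitySubbundle

end Transform

/-! ### Residual diffeomorphisms -/

section Residual

variable {M : Type*} [TopologicalSpace M] [ChartedSpace E3 M] [IsManifold (𝓡 3) (⊤ : ℕ∞) M]
  {ι : Type*}

namespace CoframeBundle

theorem finrank_residualAt_le (C : CoframeBundle ι M) (x : M) :
    Module.finrank ℝ (C.residualAt x) ≤ 3 :=
  (Submodule.finrank_le _).trans (finrank_tangentSpace x).le

/-- Every tangent vector extends to a smooth vector field, so that the residual vector fields are
all of them only if curvature and torsion vanish. -/
theorem DiffX_eq_top_iff [T2Space M] (C : CoframeBundle ι M) :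
    C.DiffX = ⊤ ↔ ∀ a, ∀ x ∈ C.bundle.domain a, ∀ u v,
      (∀ i j, C.Omega a i j x u v = 0) ∧ ∀ i, C.Tor a i x u v = 0 := by
  constructor
  · intro h a x hx u v
    obtain ⟨X, rfl⟩ := exists_vectorField_eq x u
    have hX : X ∈ C.DiffX := h ▸ Submodule.mem_top
    exact hX x a hx v
  · exact fun h => eq_top_iff.2 fun X _ x a hx v => h a x hx (X x) v

/-- By Cartan's formula, the diffeomorphism generated by `X` differs from a local translation and a
local rotation by `i_X Ω` on the spin connection and by `i_X T` on the coframe. -/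
theorem mem_DiffX_iff (C : CoframeBundle ι M) (X : VectorField M) {ϑ : ι → Fin 3 → M → ℝ}
    (hϑ : ∀ a, ∀ y ∈ C.bundle.domain a, ∀ i, ϑ a i y = interior X (C.e a i) y) :
    X ∈ C.DiffX ↔ ∀ a, ∀ x ∈ C.bundle.domain a,
      (∀ i j, lieD X (C.spin a i j) x - deltaOmega (C.spin a) 0 i j x =
        deltaOmega (C.spin a) (fun i j => interior X (C.spin a i j)) i j x) ∧
      (∀ i, lieD X (C.e a i) x - deltaE (C.spin a) (C.e a) 0 (ϑ a) i x =
        deltaE (C.spin a) (C.e a) (fun i j => interior X (C.spin a i j)) 0 i x) := by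
  have h1 (a : ι) (x : M) (hx : x ∈ C.bundle.domain a) (i j : Fin 3) :
      lieD X (C.spin a i j) x - deltaOmega (C.spin a) 0 i j x =
        deltaOmega (C.spin a) (fun i j => interior X (C.spin a i j)) i j x ↔
      ∀ v, C.Omega a i j x (X x) v = 0 := by
    rw [← sub_eq_zero, ContinuousLinearMap.ext_iff]
    refine forall_congr' fun v => iff_of_eq (congrArg (· = 0) ?_)
    exact lieD_spin_sub X (C.bundle.isOpen_domain a) (C.connection.smooth a) hx
      (fun i j => C.connection.antisymm a i j x hx) i j v
  have h2 (a : ι) (x : M) (hx : x ∈ C.bundle.domain a) (i : Fin 3) :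
      lieD X (C.e a i) x - deltaE (C.spin a) (C.e a) 0 (ϑ a) i x =
        deltaE (C.spin a) (C.e a) (fun i j => interior X (C.spin a i j)) 0 i x ↔
      ∀ v, C.Tor a i x (X x) v = 0 := by
    rw [← sub_eq_zero, ContinuousLinearMap.ext_iff]
    refine forall_congr' fun v => iff_of_eq (congrArg (· = 0) ?_)
    exact lieD_coframe_sub X (C.bundle.isOpen_domain a) (C.smooth_e a) (hϑ a) hx i v
  constructor
  · intro h a x hx
    exact ⟨fun i j => (h1 a x hx i j).2 fun v => (h x a hx v).1 i j,
      fun i => (h2 a x hx i).2 fun v => (h x a hx v).2 i⟩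
  · intro h x a hx v
    exact ⟨fun i j => (h1 a x hx i j).1 ((h a x hx).1 i j) v,
      fun i => (h2 a x hx i).1 ((h a x hx).2 i) v⟩

end CoframeBundle

end Residual

/-! ### Vector fields with given frame components -/

section FrameComponents

open Bundle Topology

namespace CoframeAtlas

variable {ι : Type*} {M : Type*} [TopologicalSpace M] [ChartedSpace E3 M]
  [IsManifold (𝓡 3) (⊤ : ℕ∞) M] (S : CoframeAtlas ι M)

/-- A vector field is smooth where its components in a smooth coframe are: the matrix of the coframe
in a chart is invertible, and inversion is smooth. -/
theorem contMDiffAt_of_components {a : ι} {x : M} (hx : x ∈ S.U a)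
    {X : ∀ y : M, TangentSpace (𝓡 3) y} {z : M → Fin 3 → ℝ}
    (hz : ContMDiffAt (𝓡 3) 𝓘(ℝ, Fin 3 → ℝ) (⊤ : ℕ∞) z x)
    (hX : ∀ y ∈ S.U a, ∀ i, S.e a i y (X y) = z y i) :
    ContMDiffAt (𝓡 3) ((𝓡 3).prod 𝓘(ℝ, E3)) (⊤ : ℕ∞)
      (fun y => (TotalSpace.mk' E3 y (X y) : TangentBundle (𝓡 3) M)) x := by
  rw [contMDiffAt_vectorField_iff]
  let K (y : M) : E3 →L[ℝ] (Fin 3 → ℝ) := ContinuousLinearMap.pi fun i => formCoord (S.e a i) x y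
  have hK : ContMDiffAt (𝓡 3) 𝓘(ℝ, E3 →L[ℝ] (Fin 3 → ℝ)) (⊤ : ℕ∞) K x := by
    have h : ContMDiffAt (𝓡 3) 𝓘(ℝ, E3 →L[ℝ] (Fin 3 → ℝ)) (⊤ : ℕ∞)
        (fun y => ∑ i, (formCoord (S.e a i) x y).smulRight (Pi.single i (1 : ℝ))) x := by
      refine contMDiffAt_finsetSum fun i _ => ?_
      have hi := (OneForm.smoothOn_iff (S.isOpen a)).1 (S.smooth_e a i) x hx
      have hb : ContDiff ℝ (⊤ : ℕ∞) fun p : (E3 →L[ℝ] ℝ) × (Fin 3 → ℝ) => p.1.smulRight p.2 :=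
        isBoundedBilinearMap_smulRight.contDiff
      exact hb.contMDiff.contMDiffAt.comp x (hi.prodMk_space contMDiffAt_const)
    refine h.congr_of_eventuallyEq (Filter.Eventually.of_forall fun y => ?_)
    refine ContinuousLinearMap.ext fun v => funext fun j => ?_
    simp [K, Pi.single_apply]
  let E (y : M) (hy : y ∈ (chartAt E3 x).source) (hya : y ∈ S.U a) : E3 ≃L[ℝ] (Fin 3 → ℝ) :=
    ((trivializationAt E3 (TangentSpace (𝓡 3)) x).continuousLinearEquivAt ℝ _
      (mem_baseSet_of_mem_source hy)).symm.trans (S.frame hya)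
  have hE (y : M) (hy : y ∈ (chartAt E3 x).source) (hya : y ∈ S.U a) :
      K y = (E y hy hya : E3 →L[ℝ] (Fin 3 → ℝ)) :=
    ContinuousLinearMap.ext fun v => congrArg (S.frame hya)
      (congrFun (Trivialization.symm_continuousLinearEquivAt_eq _
        (mem_baseSet_of_mem_source hy)) v).symm
  have hinv : ContMDiffAt (𝓡 3) 𝓘(ℝ, (Fin 3 → ℝ) →L[ℝ] E3) (⊤ : ℕ∞)
      (fun y => (K y).inverse) x := by
    have h := contDiffAt_map_inverse (𝕜 := ℝ) (n := (⊤ : ℕ∞)) (E x (mem_chart_source E3 x) hx)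
    rw [← hE x (mem_chart_source E3 x) hx] at h
    exact h.contMDiffAt.comp x hK
  refine (hinv.clm_apply hz).congr_of_eventuallyEq ?_
  filter_upwards [(S.isOpen a).mem_nhds hx, eventually_mem_chart_source x] with y hya hy
  rw [hE y hy hya, ContinuousLinearMap.inverse_equiv]
  refine ((E y hy hya).eq_symm_apply).2 ?_
  refine (DFunLike.congr_fun (hE y hy hya) _).symm.trans (funext fun i => ?_)
  exact (congrArg (S.e a i y) (coordFrame_coordCoframe hy (X y))).trans (hX y hya i)

/-- Components in the local coframes which transform with the transition functions are those of a
vector field. -/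
theorem exists_vectorField (z : ι → M → Fin 3 → ℝ)
    (hz : ∀ a, ContMDiffOn (𝓡 3) 𝓘(ℝ, Fin 3 → ℝ) (⊤ : ℕ∞) (z a) (S.U a))
    (hg : ∀ a b, ∀ x ∈ S.U a ∩ S.U b, z a x = (S.g a b x).1 *ᵥ z b x) :
    ∃ X : VectorField M, ∀ a, ∀ x ∈ S.U a, ∀ i, S.e a i x (X x) = z a x i := by
  let X (x : M) : TangentSpace (𝓡 3) x := (S.frame (S.mem_index x)).symm (z (S.index x) x)
  have hX (a : ι) (x : M) (hx : x ∈ S.U a) (i : Fin 3) : S.e a i x (X x) = z a x i := by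
    refine congrFun ((S.frame_eq_mulVec hx (S.mem_index x) (X x)).trans ?_) i
    rw [hg a (S.index x) x ⟨hx, S.mem_index x⟩]
    exact congrArg _ ((S.frame (S.mem_index x)).apply_symm_apply _)
  exact ⟨⟨X, fun x => S.contMDiffAt_of_components (S.mem_index x)
    ((hz _).contMDiffAt ((S.isOpen _).mem_nhds (S.mem_index x))) (hX _)⟩, hX⟩

theorem ext_rotation {a : ι} {c c' : Coframe S.orientedMetric} (hc : c.base ∈ S.U a)
    (h : c.base = c'.base) (hr : S.rotation a c = S.rotation a c') : c = c' :=
  (S.trivialization a).injOn hc (show c'.base ∈ S.U a from h ▸ hc) (Prod.ext h hr)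

end CoframeAtlas

end FrameComponents

/-! ### The map from the gauge bundle to the coframe bundle -/

section Splitting

open Topology

variable {M : Type*} [TopologicalSpace M] [ChartedSpace E3 M] [IsManifold (𝓡 3) (⊤ : ℕ∞) M]
  {P : Type*} [TopologicalSpace P] [MulAction Poincareᵐᵒᵖ P] {ι : Type*}
  {B : PrincipalBundle Poincare Poincare.coords ι M P}

theorem Poincare.continuous_rot : Continuous Poincare.rot :=
  continuous_fst.comp (f := fun g : Poincare => (g.rot, g.trans)) continuous_induced_dom

namespace StabilitySubbundle

variable (Q : StabilitySubbundle B) (H : PoincareConnection B) {μ : ℝ} (hμ : μ ≠ 0)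
  (hθ : ∀ a, ∀ x ∈ B.domain a, ∀ v : TangentSpace (𝓡 3) x,
    (∀ i, Q.theta H a i x v = 0) → v = 0)

/-- The local coframes `e^i = μ⁻¹ θ^i`, whose transition functions are the images under `Γ₁` of
those of the gauge bundle. -/
noncomputable def coframeAtlas : CoframeAtlas ι M where
  U := B.domain
  isOpen := B.isOpen_domain
  index x := (B.cover x).choose
  mem_index x := (B.cover x).choose_spec
  e a i := fun x => μ⁻¹ • Q.theta H a i x
  smooth_e a i := .smul (B.isOpen_domain a) contMDiffOn_const (Q.smoothOn_theta H a i)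
  nondegenerate a x hx v hv := hθ a x hx v fun i =>
    (mul_eq_zero.1 (hv i)).resolve_left (inv_ne_zero hμ)
  g a b x := Gamma1 (B.transition a b x).rot
  smooth_g := contMDiffOn_transition_Gamma1 B
  e_eq _ _ _ hx v := (congrArg (μ⁻¹ • ·) (Q.theta_transform H hx v)).trans
    (Matrix.mulVec_smul _ _ _).symm

/-- The Riemann-Cartan structure given by the gauge fields. -/
noncomputable def coframeBundle : CoframeBundle ι M :=
  (Q.coframeAtlas H hμ hθ).coframeBundle (fun a => spinForm (H.A a))
    (fun a => smoothOn_spinForm (B.isOpen_domain a) (H.smooth_A a))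
    (fun a => spinForm_antisymm (H.A a)) (fun _ _ _ hx v => H.spinForm_transform hx v)

/-- The bundle map `f`, which sends a point with group coordinates `(u, w)` over `U_a` to the coframe
`Γ₁(u)⁻¹ e_a`. -/
noncomputable def toCoframe (p : P) : Coframe (Q.coframeAtlas H hμ hθ).orientedMetric :=
  (Q.coframeAtlas H hμ hθ).coframe ((Q.coframeAtlas H hμ hθ).mem_index (B.proj p))
    (Gamma1 (B.triv ((Q.coframeAtlas H hμ hθ).index (B.proj p)) p).2.rot)

/-- The definition of `f` does not depend on the local trivialization. -/
theorem rotation_toCoframe {a : ι} {p : P} (ha : B.proj p ∈ B.domain a) :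
    (Q.coframeAtlas H hμ hθ).rotation a (Q.toCoframe H hμ hθ p) =
      Gamma1 (B.triv a p).2.rot := by
  set S := Q.coframeAtlas H hμ hθ with hS
  have hi : B.proj p ∈ B.domain (S.index (B.proj p)) := S.mem_index (B.proj p)
  refine (S.rotation_coframe_eq_g (a := a) ha (S.mem_index (B.proj p)) _).trans ?_
  rw [B.triv_eq_transition_mul ha hi, Poincare.mul_def, map_mul]
  rfl

theorem continuous_toCoframe : Continuous (Q.toCoframe H hμ hθ) := by
  set S := Q.coframeAtlas H hμ hθ with hS
  refine continuous_iff_continuousAt.2 fun p => ?_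
  obtain ⟨a, ha⟩ := B.cover (B.proj p)
  have hp : p ∈ (B.triv a).source := (B.mem_source_iff a p).2 ha
  have ht : ContinuousAt (fun q => (B.triv a q).2) p :=
    continuousAt_snd.comp ((B.triv a).toOpenPartialHomeomorph.continuousAt hp)
  have hc : ContinuousAt (fun q => (B.proj q, Gamma1 (B.triv a q).2.rot)) p :=
    ((B.triv a).continuousAt_proj hp).prodMk
      ((continuous_Gamma1.comp Poincare.continuous_rot).continuousAt.comp ht)
  have hf := ContinuousAt.comp (g := S.coframeAt a)
    (f := fun q => (B.proj q, Gamma1 (B.triv a q).2.rot)) (x := p)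
    (S.continuousAt_coframeAt (B.proj p, Gamma1 (B.triv a p).2.rot) ha) hc
  refine hf.congr ?_
  filter_upwards [(B.triv a).open_source.mem_nhds hp] with q hq
  have hq' : B.proj q ∈ B.domain a := (B.mem_source_iff a q).1 hq
  refine (S.coframeAt_of_mem (p := (B.proj q, _)) hq').trans ?_
  rw [← Q.rotation_toCoframe H hμ hθ hq']
  exact S.coframe_rotation (Q.toCoframe H hμ hθ q) hq'

theorem toCoframe_smul (p : P) (g : Poincare) :
    Q.toCoframe H hμ hθ (MulOpposite.op g • p) =
      MulOpposite.op (Gamma1 g.rot) • Q.toCoframe H hμ hθ p := by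
  obtain ⟨a, ha⟩ := B.cover (B.proj p)
  have ha' : B.proj (MulOpposite.op g • p) ∈ B.domain a := by rwa [B.proj_smul]
  refine (Q.coframeAtlas H hμ hθ).ext_rotation (a := a) ha' (B.proj_smul p g) ?_
  rw [(Q.coframeAtlas H hμ hθ).rotation_smul (Q.toCoframe H hμ hθ p) ha,
    Q.rotation_toCoframe H hμ hθ ha, Q.rotation_toCoframe H hμ hθ ha', B.triv_smul ha,
    Poincare.mul_def, map_mul]

/-- The sub-bundle contains points with every `SU(2)`-coordinate, so that it is mapped onto the
coframe bundle because `Γ₁` is surjective. -/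
theorem image_toCoframe : Q.toCoframe H hμ hθ '' Q.carrier = Set.univ := by
  set S := Q.coframeAtlas H hμ hθ with hS
  refine Set.eq_univ_of_forall fun c => ?_
  have hc : c.base ∈ B.domain (S.index c.base) := S.mem_index c.base
  obtain ⟨u, hu⟩ := surjective_Gamma1 (S.rotation (S.index c.base) c)
  have hp := B.proj_point hc (⟨u, Q.s (S.index c.base) c.base⟩ : Poincare)
  have hd : B.proj (B.point (S.index c.base) c.base
      (⟨u, Q.s (S.index c.base) c.base⟩ : Poincare)) ∈ B.domain (S.index c.base) := by rwa [hp]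
  refine ⟨_, (Q.mem_iff _ _ ((B.mem_source_iff _ _).2 hd)).2 ?_,
    S.ext_rotation (a := S.index c.base) hd hp ?_⟩
  · rw [B.triv_point hc, hp]
  · rw [Q.rotation_toCoframe H hμ hθ hd, B.triv_point hc, hu]

/-- The components of a vector field in the coframe `f p` are an equivariant function of `p`. -/
noncomputable def parameterOfField (X : VectorField M) (p : P) : Fin 3 → ℝ :=
  μ • (Q.toCoframe H hμ hθ p).frame (X (Q.toCoframe H hμ hθ p).base)

theorem parameterOfField_smul (X : VectorField M) (p : P) (g : Poincare) :
    Q.parameterOfField H hμ hθ X (MulOpposite.op g • p) =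
      (Gamma1 g.rot⁻¹).1 *ᵥ Q.parameterOfField H hμ hθ X p := by
  have h (c c' : Coframe (Q.coframeAtlas H hμ hθ).orientedMetric) (hc : c = c') :
      c.frame (X c.base) = c'.frame (X c'.base) := by rw [hc]
  refine (congrArg (μ • ·) (h _ _ (Q.toCoframe_smul H hμ hθ p g))).trans ?_
  rw [map_inv]
  exact (Matrix.mulVec_smul (Gamma1 g.rot)⁻¹.1 μ _).symm

theorem parameterOfField_localSection (X : VectorField M) {a : ι} {x : M} (hx : x ∈ B.domain a) :
    Q.parameterOfField H hμ hθ X (B.localSection a x) =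
      μ • fun i => interior X ((Q.coframeAtlas H hμ hθ).e a i) x := by
  set S := Q.coframeAtlas H hμ hθ with hS
  have hp := B.proj_localSection hx
  have hd : B.proj (B.localSection a x) ∈ B.domain a := by rwa [hp]
  have h1 := S.rotation_spec (Q.toCoframe H hμ hθ (B.localSection a x)) (a := a) hd
    (X (B.proj (B.localSection a x)))
  rw [Q.rotation_toCoframe H hμ hθ hd, B.triv_localSection hx] at h1
  have h2 : (Gamma1 (1 : Poincare).rot).1 = 1 := congrArg Subtype.val (map_one Gamma1)
  rw [h2, Matrix.one_mulVec] at h1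
  refine congrArg (μ • ·) (h1.symm.trans (funext fun i => ?_))
  exact congrArg (interior X (S.e a i)) hp

theorem parameterOfField_mem (X : VectorField M) :
    Q.parameterOfField H hμ hθ X ∈ translationParameters B := by
  refine ⟨Q.parameterOfField_smul H hμ hθ X, fun a => contMDiffOn_pi_space.2 fun i => ?_⟩
  have h := contMDiffOn_interior X (B.isOpen_domain a) ((Q.coframeAtlas H hμ hθ).smooth_e a i)
  refine (contMDiffOn_const (c := μ).mul h).congr fun x hx => ?_
  rw [Q.parameterOfField_localSection H hμ hθ X hx]
  rfl

/-- The map from vector fields to gauge parameters inverse to `Γ₂`. -/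
noncomputable def fieldToParameter : VectorField M →ₗ[ℝ] translationParameters B where
  toFun X := ⟨Q.parameterOfField H hμ hθ X, Q.parameterOfField_mem H hμ hθ X⟩
  map_add' _ _ := Subtype.ext (funext fun p =>
    (congrArg (μ • ·) (map_add (Q.toCoframe H hμ hθ p).frame _ _)).trans (smul_add _ _ _))
  map_smul' c _ := Subtype.ext (funext fun p =>
    (congrArg (μ • ·) (map_smul (Q.toCoframe H hμ hθ p).frame c _)).trans (smul_comm _ _ _))

/-- A vector field is determined by its components in the local coframes, and an equivariant function
gives components which transform as those of a vector field. -/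
theorem fieldToParameter_bijective : Function.Bijective (Q.fieldToParameter H hμ hθ) := by
  set S := Q.coframeAtlas H hμ hθ with hS
  constructor
  · refine (injective_iff_map_eq_zero _).2 fun X hX => ContMDiffSection.ext fun x => ?_
    have hx : x ∈ B.domain (S.index x) := S.mem_index x
    have h : Q.parameterOfField H hμ hθ X (B.localSection (S.index x) x) = 0 :=
      congrFun (congrArg Subtype.val hX) _
    rw [Q.parameterOfField_localSection H hμ hθ X hx, smul_eq_zero_iff_right hμ] at h
    exact S.nondegenerate _ x hx (X x) fun i => congrFun h i
  · intro ζ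
    have hloc (a : ι) (x : M) (hx : x ∈ B.domain a) {p : P} (hp : B.proj p = x) :
        ζ.1 p = (Gamma1 (B.triv a p).2.rot⁻¹).1 *ᵥ ζ.1 (B.localSection a x) := by
      subst hp
      conv_lhs => rw [B.eq_smul_localSection hx]
      exact ζ.2.1 _ _
    have hc {U : Set M} : ContMDiffOn (𝓡 3) 𝓘(ℝ, ℝ) (⊤ : ℕ∞) (fun _ : M => μ⁻¹) U :=
      contMDiffOn_const
    obtain ⟨X, hX⟩ := S.exists_vectorField (fun a x => μ⁻¹ • ζ.1 (B.localSection a x))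
      (fun a => hc.smul (ζ.2.2 a)) (fun a b x hx => by
        have h := hloc a x hx.1 (B.proj_localSection hx.2)
        rw [map_inv] at h
        rw [Matrix.mulVec_smul, h]
        exact congrArg (μ⁻¹ • ·) (so3_mulVec_inv_mulVec _ _).symm)
    refine ⟨X, Subtype.ext (funext fun p => ?_)⟩
    obtain ⟨a, ha⟩ := B.cover (B.proj p)
    change Q.parameterOfField H hμ hθ X p = ζ.1 p
    rw [hloc a _ ha rfl]
    conv_lhs => rw [B.eq_smul_localSection ha]
    rw [Q.parameterOfField_smul, Q.parameterOfField_localSection H hμ hθ X ha]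
    refine congrArg _ (funext fun i => ?_)
    refine (congrArg (μ * ·) (hX a _ ha i)).trans ?_
    exact mul_inv_cancel_left₀ hμ _

/-- The isomorphism `Γ₂` from gauge parameters to vector fields. -/
noncomputable def parameterEquiv : translationParameters B ≃ₗ[ℝ] VectorField M :=
  (LinearEquiv.ofBijective (Q.fieldToParameter H hμ hθ)
    (Q.fieldToParameter_bijective H hμ hθ)).symm

theorem interior_parameterEquiv (ζ : translationParameters B) {a : ι} {x : M}
    (hx : x ∈ B.domain a) (i : Fin 3) :
    (Q.coframeAtlas H hμ hθ).e a i x (Q.parameterEquiv H hμ hθ ζ x) =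
      μ⁻¹ * ζ.1 (B.localSection a x) i := by
  have h : Q.fieldToParameter H hμ hθ (Q.parameterEquiv H hμ hθ ζ) = ζ :=
    (LinearEquiv.ofBijective (Q.fieldToParameter H hμ hθ)
      (Q.fieldToParameter_bijective H hμ hθ)).apply_symm_apply ζ
  have h1 : Q.parameterOfField H hμ hθ (Q.parameterEquiv H hμ hθ ζ) (B.localSection a x) =
      ζ.1 (B.localSection a x) := congrFun (congrArg Subtype.val h) _
  rw [← h1, Q.parameterOfField_localSection H hμ hθ _ hx]
  exact (inv_mul_cancel_left₀ hμ _).symm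

end StabilitySubbundle

end Splitting

end GaugeGravity

open GaugeGravity in
theorem mainTheorem1 {M : Type*} [TopologicalSpace M] [T2Space M] [ParacompactSpace M]
    [ChartedSpace E3 M] [IsManifold (𝓡 3) (⊤ : ℕ∞) M]
    {P : Type*} [TopologicalSpace P] [MulAction Poincareᵐᵒᵖ P] {ι : Type*}
    (B : PrincipalBundle Poincare Poincare.coords ι M P) (H : PoincareConnection B) :
    -- `Γ₁ : SU(2) → SO(3)`, a double covering homomorphism under which `L_k = ½ ε_{kpq} L_{pq}`
    (Continuous Gamma1 ∧ Function.Surjective Gamma1 ∧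
      (∀ u : SU2, Gamma1 u = 1 ↔ u.1 = 1 ∨ u.1 = -1) ∧
      ∀ (γ : ℝ → SU2) (a : Fin 3 → ℝ), γ 0 = 1 →
        (∀ k l, HasDerivAt (fun t => (γ t).1 k l) (su2Alg a k l) 0) →
        ∀ i j, HasDerivAt (fun t => (Gamma1 (γ t)).1 i j)
          ((∑ k, a k • ((1 / 2 : ℝ) • ∑ p, ∑ q, eps k p q • so3Gen p q)) i j) 0) ∧
    -- `P` splits off a sub-bundle `P_A` with structure group `SU(2)`
    Nonempty (StabilitySubbundle B) ∧
    -- for every such splitting whose coset field `θ` is a local isomorphism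
    ∀ (Q : StabilitySubbundle B) (μ : ℝ), μ ≠ 0 →
      (∀ a, ∀ x ∈ B.domain a, ∀ v : TangentSpace (𝓡 3) x,
        (∀ i, Q.theta H a i x v = 0) → v = 0) →
      ∃ (C : CoframeBundle ι M) (f : P → Coframe C.geometry),
        -- the bundle map `f : P → P'`: it covers `Γ₃ = id : M → M'`, is equivariant along `Γ₁`, is
        -- `id × Γ₁` in the local trivializations, and restricts to a surjection of `P_A`
        (Continuous f ∧ (∀ p, (f p).base = B.proj p) ∧
          (∀ p (g : Poincare),
            f (MulOpposite.op g • p) = MulOpposite.op (Gamma1 g.rot) • f p) ∧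
          (∀ a, C.bundle.domain a = B.domain a) ∧
          (∀ a, ∀ p ∈ (B.triv a).source,
            C.bundle.triv a (f p) = (B.proj p, Gamma1 (B.triv a p).2.rot)) ∧
          f '' Q.carrier = Set.univ) ∧
        -- `Γ₄ : (A, θ) → (ω, e)` with `A^k = -½ ε^{kij} ω_{ij}` and `θ^i = μ e^i`
        (∀ a, ∀ x ∈ B.domain a,
          (∀ k, H.A a k x = (-(1 / 2) : ℝ) • ∑ i, ∑ j, eps k i j • C.spin a i j x) ∧
          (∀ i, Q.theta H a i x = μ • C.e a i x) ∧
          -- it sends field strengths to curvature and torsion,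
          (∀ i j u v, C.Omega a i j x u v = -∑ k, eps i j k * fieldF (H.A a) k x u v) ∧
          (∀ i u v, C.Tor a i x u v = μ⁻¹ * fieldPi (H.A a) (Q.theta H a) i x u v) ∧
          -- the Chern-Simons Lagrangian to the Einstein-Hilbert one,
          (∀ u v w, ∑ i, wedge12 (Q.theta H a i) (fieldF (H.A a) i) x u v w =
            -(μ / 2) * ∑ i, ∑ j, ∑ k, eps i j k * wedge12 (C.e a i) (C.Omega a j k) x u v w) ∧
          -- and gauge transformations to `δω^{ij} = ∇α^{ij}`, `δe^i = ∇ϑ^i - α^{ij} e^j`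
          (∀ α ζ : Fin 3 → M → ℝ,
            (∀ i, ContMDiffOn (𝓡 3) 𝓘(ℝ, ℝ) (⊤ : ℕ∞) (α i) (B.domain a)) →
            (∀ i, ContMDiffOn (𝓡 3) 𝓘(ℝ, ℝ) (⊤ : ℕ∞) (ζ i) (B.domain a)) →
            (∀ i j, deltaOmega (C.spin a) (fun i j y => -∑ k, eps i j k * α k y) i j x =
              -∑ k, eps i j k • deltaA (H.A a) α k x) ∧
            (∀ i, deltaE (C.spin a) (C.e a) (fun i j y => -∑ k, eps i j k * α k y)
                (fun i y => μ⁻¹ * ζ i y) i x =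
              μ⁻¹ • deltaTheta (H.A a) (Q.theta H a) α ζ i x))) ∧
        -- `Γ₂`: `ℝ³`-parameters `ζ` correspond to vector fields `X` on `M'` by `i_X e^i = ζ^i / μ`, and
        -- `X ∈ Diff(D)_X` iff the `ℝ³`-transformation agrees on `(ω, e)` with the diffeomorphism
        -- generated by `X` up to the local isometry with parameter `i_X ω^{ij}`
        (∃ Gamma2 : translationParameters B ≃ₗ[ℝ] VectorField M,
          (∀ (ζ : translationParameters B) a, ∀ x ∈ B.domain a, ∀ i,
            C.e a i x (Gamma2 ζ x) = μ⁻¹ * ζ.1 (B.localSection a x) i) ∧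
          ∀ ζ : translationParameters B, Gamma2 ζ ∈ C.DiffX ↔
            ∀ a, ∀ x ∈ B.domain a,
              (∀ i j, lieD (Gamma2 ζ) (C.spin a i j) x - deltaOmega (C.spin a) 0 i j x =
                deltaOmega (C.spin a) (fun i j => interior (Gamma2 ζ) (C.spin a i j)) i j x) ∧
              (∀ i, lieD (Gamma2 ζ) (C.e a i) x - deltaE (C.spin a) (C.e a) 0
                    (fun i y => μ⁻¹ * ζ.1 (B.localSection a y) i) i x =
                deltaE (C.spin a) (C.e a)
                  (fun i j => interior (Gamma2 ζ) (C.spin a i j)) 0 i x)) ∧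
        -- `D ≤ 3`, and no diffeomorphism is broken exactly when `Ω` and `T` vanish
        (∀ x, Module.finrank ℝ (C.residualAt x) ≤ 3) ∧
        (C.DiffX = ⊤ ↔ ∀ a, ∀ x ∈ B.domain a, ∀ u v,
          (∀ i j, C.Omega a i j x u v = 0) ∧ ∀ i, C.Tor a i x u v = 0) := by
  refine ⟨⟨continuous_Gamma1, surjective_Gamma1, Gamma1_eq_one_iff, hasDerivAt_Gamma1_at_one⟩,
    nonempty_stabilitySubbundle B, fun Q μ hμ hθ => ?_⟩
  refine ⟨Q.coframeBundle H hμ hθ, Q.toCoframe H hμ hθ, ⟨Q.continuous_toCoframe H hμ hθ,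
    fun _ => rfl, Q.toCoframe_smul H hμ hθ, fun _ => rfl, fun a p hp => ?_,
    Q.image_toCoframe H hμ hθ⟩, fun a x hx => ?_,
    ⟨Q.parameterEquiv H hμ hθ, fun ζ a x hx i => Q.interior_parameterEquiv H hμ hθ ζ hx i,
      fun ζ => ?_⟩, fun x => CoframeBundle.finrank_residualAt_le _ x,
    CoframeBundle.DiffX_eq_top_iff _⟩
  · exact Prod.ext rfl (Q.rotation_toCoframe H hμ hθ ((B.mem_source_iff a p).1 hp))
  · have hU := B.isOpen_domain a
    have hA := H.smooth_A a
    have ht := Q.smoothOn_theta H a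
    refine ⟨fun k => eq_sum_spinForm (H.A a) k x, fun i => (smul_inv_smul₀ hμ _).symm,
      fun i j u v => curvature_spinForm hU hA hx i j u v,
      fun i u v => torsion_spinForm hU ht μ hx i u v,
      fun u v w => sum_wedge12_fieldF hU hA hμ hx u v w, fun α ζ hα hζ => ⟨fun i j => ?_, fun i => ?_⟩⟩
    · exact deltaOmega_spinForm (H.A a)
        (fun i => ((hα i).contMDiffAt (hU.mem_nhds hx)).mdifferentiableAt (by simp)) i j
    · exact deltaE_spinForm (H.A a) (Q.theta H a) μ
        (fun i => ((hζ i).contMDiffAt (hU.mem_nhds hx)).mdifferentiableAt (by simp)) i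
  · exact CoframeBundle.mem_DiffX_iff (Q.coframeBundle H hμ hθ) (Q.parameterEquiv H hμ hθ ζ)
      (ϑ := fun a i y => μ⁻¹ * ζ.1 (B.localSection a y) i)
      fun a y hy i => (Q.interior_parameterEquiv H hμ hθ ζ hy i).symm
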